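/- Let $\mathbb D$ be the open unit disc, $L^p=L^p(\partial\mathbb D,\frac{|dz|}{2\pi})$, $H^2\subset L^2$ the Hardy space (functions identified with their boundary functions) and $H^\infty$ the bounded analytic functions on $\mathbb D$. Let $\Theta$ be a nonconstant inner function, i.e. a nonconstant $\Theta\in H^\infty$ whose radial limits, also denoted $\Theta(z)$, have modulus one for almost every $z\in\partial\mathbb D$. Put $K_\Theta=H^2\cap(\Theta H^2)^\perp$ and $K_\Theta^\infty=H^\infty\cap K_\Theta$, and let $P_\Theta$ be the orthogonal projection of $L^2$ onto $K_\Theta$. For $\varphi\in L^2$ let $A_\varphi f=P_\Theta(\varphi f)$ for $f\in K_\Theta^\infty$, and $$\|A_\varphi\|=\sup\{\|A_\varphi f\|_{L^2}: f\in K_\Theta^\infty,\ \|f\|_{L^2}=1\}\in[0,\infty].$$ Let $D_\Theta$ be the set of $\zeta\in\partial\mathbb D$ at which $\Theta$ has a finite angular derivative, i.e. $\Theta$ has a non-tangential limit $\Theta(\zeta)$ of modulus one at $\zeta$ and $\Theta'$ has a finite non-tangential limit $\Theta'(\zeta)$ at $\zeta$. Then for every $\zeta\in D_\Theta$ one has $\Theta'(\zeta)\neq0$,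 and $$d\nu_\zeta(z)=\frac1{|\Theta'(\zeta)|}\left|\frac{\Theta(z)-\Theta(\zeta)}{z-\zeta}\right|^2\frac{|dz|}{2\pi}$$ is a probability measure on $\partial\mathbb D$. Moreover, if $\varphi\in L^\infty$, or if $\varphi\in L^2$ with $\varphi\ge0$ almost everywhere, then $$\sup_{\zeta\in D_\Theta}\frac1{|\Theta'(\zeta)|}\left|\int_{\partial\mathbb D}\varphi(z)\left|\frac{\Theta(z)-\Theta(\zeta)}{z-\zeta}\right|^2\frac{|dz|}{2\pi}\right|\le\|A_\varphi\|,$$ that is, $\sup_{\zeta\in D_\Theta}\left|\int_{\partial\mathbb D}\varphi\,d\nu_\zeta\right|\le\|A_\varphi\|$. The supremum over the empty set is $0$. For $\varphi\in L^\infty$ the integrals converge absolutely; for $\varphi\ge0$ both the integrals and $\|A_\varphi\|$ may be $+\infty$, and the inequality is understood in $[0,\infty]$. -/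

import Mathlib

open MeasureTheory Filter Topology
open scoped ENNReal

namespace TruncatedToeplitz

noncomputable section

/-! ### The unit circle and `L²` -/

instance : MeasurableSpace Circle := borel Circle

instance : BorelSpace Circle := ⟨rfl⟩

instance : Fact (0 < 2 * Real.pi) := ⟨Real.two_pi_pos⟩

/-- Normalized arc length `|dz| / 2π` on the unit circle: the image of the normalized Lebesgue
measure of `ℝ / 2πℤ` under `θ ↦ e^{iθ}`. -/
def arcLength : Measure Circle :=
  (AddCircle.haarAddCircle : Measure (AddCircle (2 * Real.pi))).map AddCircle.homeomorphCircle'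

instance : IsProbabilityMeasure arcLength :=
  Measure.isProbabilityMeasure_map AddCircle.homeomorphCircle'.continuous.measurable.aemeasurable

/-- The Hilbert space `L²` of the unit circle. -/
abbrev L2 : Type := Lp ℂ 2 arcLength

/-! ### Boundary behaviour of functions on the unit disc -/

/-- `f` has the radial limit `l` at the boundary point `ζ`. -/
def HasRadialLimit (f : ℂ → ℂ) (ζ : Circle) (l : ℂ) : Prop :=
  Tendsto (fun r : ℝ => f (r * (ζ : ℂ))) (𝓝[<] 1) (𝓝 l)

/-- The Stolz (non-tangential approach) region of aperture `α` with vertex `ζ`. -/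
def stolzRegion (ζ : Circle) (α : ℝ) : Set ℂ :=
  {z | ‖z‖ < 1 ∧ ‖z - (ζ : ℂ)‖ < α * (1 - ‖z‖)}

/-- `f` has the non-tangential limit `l` at the boundary point `ζ`. -/
def HasNontangentialLimit (f : ℂ → ℂ) (ζ : Circle) (l : ℂ) : Prop :=
  ∀ α : ℝ, 1 < α → Tendsto f (𝓝[stolzRegion ζ α] (ζ : ℂ)) (𝓝 l)

/-- The boundary function of `f`: its radial limit, wherever that exists. -/
def boundaryValue (f : ℂ → ℂ) (ζ : Circle) : ℂ :=
  limUnder (𝓝[<] (1 : ℝ)) (fun r : ℝ => f (r * (ζ : ℂ)))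

theorem HasRadialLimit.boundaryValue_eq {f : ℂ → ℂ} {ζ : Circle} {l : ℂ}
    (h : HasRadialLimit f ζ l) : boundaryValue f ζ = l :=
  Tendsto.limUnder_eq h

/-- A non-tangential limit is in particular a radial limit. -/
theorem HasNontangentialLimit.hasRadialLimit {f : ℂ → ℂ} {ζ : Circle} {l : ℂ}
    (h : HasNontangentialLimit f ζ l) : HasRadialLimit f ζ l := by
  refine (h 2 one_lt_two).comp (tendsto_nhdsWithin_iff.2 ⟨?_, ?_⟩)
  · have hc : Continuous fun r : ℝ => (r : ℂ) * (ζ : ℂ) := by fun_prop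
    have := hc.tendsto 1
    simp only [Complex.ofReal_one, one_mul] at this
    exact this.mono_left nhdsWithin_le_nhds
  · filter_upwards [Ioo_mem_nhdsLT (zero_lt_one' ℝ)] with r hr
    have h1 : ‖(r : ℂ) * (ζ : ℂ)‖ = r := by
      rw [norm_mul, Circle.norm_coe, mul_one, Complex.norm_real, Real.norm_of_nonneg hr.1.le]
    have h2 : ‖(r : ℂ) * (ζ : ℂ) - (ζ : ℂ)‖ = 1 - r := by
      have : (r : ℂ) * (ζ : ℂ) - (ζ : ℂ) = ((r - 1 : ℝ) : ℂ) * (ζ : ℂ) := by push_cast; ring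
      rw [this, norm_mul, Circle.norm_coe, mul_one, Complex.norm_real, Real.norm_eq_abs,
        abs_of_neg (by linarith [hr.2])]
      ring
    refine ⟨by rw [h1]; exact hr.2, ?_⟩
    rw [h1, h2]
    linarith [hr.2]

/-- `f` is a bounded analytic function on the open unit disc. -/
def IsBoundedAnalytic (f : ℂ → ℂ) : Prop :=
  DifferentiableOn ℂ f (Metric.ball 0 1) ∧ ∃ C : ℝ, ∀ z ∈ Metric.ball (0 : ℂ) 1, ‖f z‖ ≤ C

/-- An inner function: a bounded analytic function on the open unit disc that has radial limits of
modulus one at almost every point of the unit circle. -/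
def IsInner (Θ : ℂ → ℂ) : Prop :=
  IsBoundedAnalytic Θ ∧ ∀ᵐ ζ ∂arcLength, ∃ l : ℂ, ‖l‖ = 1 ∧ HasRadialLimit Θ ζ l

/-- `Θ` has a finite angular derivative at `ζ`: it has a non-tangential limit of modulus one and
its derivative has a finite non-tangential limit. Those limits are `boundaryValue Θ ζ` and
`boundaryValue (deriv Θ) ζ`. -/
def HasFiniteAngularDerivative (Θ : ℂ → ℂ) (ζ : Circle) : Prop :=
  (∃ w : ℂ, ‖w‖ = 1 ∧ HasNontangentialLimit Θ ζ w) ∧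
    ∃ d : ℂ, HasNontangentialLimit (deriv Θ) ζ d

/-- The set of boundary points at which `Θ` has a finite angular derivative. -/
def angularSet (Θ : ℂ → ℂ) : Set Circle :=
  {ζ | HasFiniteAngularDerivative Θ ζ}

/-- The angular derivative of `Θ` at `ζ` (meaningful for `ζ ∈ angularSet Θ`). -/
def angularDeriv (Θ : ℂ → ℂ) (ζ : Circle) : ℂ :=
  boundaryValue (deriv Θ) ζ

/-! ### Hardy space, model space, truncated Toeplitz operators -/

theorem continuous_circle_coe : Continuous fun z : Circle => (z : ℂ) :=
  continuous_subtype_val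

theorem memLp_pow (n : ℕ) (p : ℝ≥0∞) : MemLp (fun z : Circle => (z : ℂ) ^ n) p arcLength :=
  MemLp.of_bound (continuous_circle_coe.pow n).aestronglyMeasurable 1
    (ae_of_all _ fun z => by rw [norm_pow, Circle.norm_coe, one_pow])

theorem integrable_pow_mul (n : ℕ) (g : L2) :
    Integrable (fun z : Circle => (z : ℂ) ^ n * g z) arcLength :=
  memLp_one_iff_integrable.1 (((Lp.memLp g).mono_exponent one_le_two).mul' (memLp_pow n ∞))

/-- The Hardy space `H²`, regarded through boundary functions as a subspace of `L²`: the functions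
all of whose Fourier coefficients of negative index `-n`, i.e. `∫ zⁿ g(z) |dz| / 2π` with `n > 0`,
vanish. -/
def hardySpace : Submodule ℂ L2 where
  carrier := {g | ∀ n : ℕ, 0 < n → ∫ z, (z : ℂ) ^ n * g z ∂arcLength = 0}
  zero_mem' := by
    intro n _
    refine integral_eq_zero_of_ae ?_
    filter_upwards [Lp.coeFn_zero ℂ 2 arcLength] with z hz
    rw [hz, Pi.zero_apply, mul_zero]
  add_mem' := by
    intro f g hf hg n hn
    have : ∫ z, (z : ℂ) ^ n * (f + g) z ∂arcLength
        = ∫ z, ((z : ℂ) ^ n * f z + (z : ℂ) ^ n * g z) ∂arcLength := by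
      refine integral_congr_ae ?_
      filter_upwards [Lp.coeFn_add f g] with z hz
      rw [hz, Pi.add_apply, mul_add]
    rw [this, integral_add (integrable_pow_mul n f) (integrable_pow_mul n g), hf n hn, hg n hn,
      add_zero]
  smul_mem' := by
    intro c f hf n hn
    have : ∫ z, (z : ℂ) ^ n * (c • f) z ∂arcLength
        = ∫ z, c * ((z : ℂ) ^ n * f z) ∂arcLength := by
      refine integral_congr_ae ?_
      filter_upwards [Lp.coeFn_smul c f] with z hz
      rw [hz, Pi.smul_apply, smul_eq_mul]
      ring
    rw [this, integral_const_mul, hf n hn, mul_zero]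

theorem isClosed_hardySpace : IsClosed (hardySpace : Set L2) := by
  have key : (hardySpace : Set L2) = ⋂ n : ℕ, ⋂ _ : 0 < n,
      {g : L2 | inner ℂ ((memLp_pow n 2).star.toLp _ : L2) g = 0} := by
    ext g
    simp only [Set.mem_iInter, Set.mem_ofPred_eq]
    refine forall₂_congr fun n _ => ?_
    have : inner ℂ ((memLp_pow n 2).star.toLp _ : L2) g
        = ∫ z, (z : ℂ) ^ n * g z ∂arcLength := by
      rw [L2.inner_def]
      refine integral_congr_ae ?_
      filter_upwards [(memLp_pow n 2).star.coeFn_toLp] with z hz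
      rw [hz, RCLike.inner_apply, Pi.star_apply, RCLike.star_def, Complex.conj_conj, mul_comm]
    rw [this]
  rw [key]
  refine isClosed_iInter fun n => isClosed_iInter fun _ => ?_
  exact isClosed_eq (by fun_prop) continuous_const

/-- The subspace `Θ H²` of `L²`: all products of the boundary function of `Θ` with a function
in `H²`. -/
def shiftedHardySpace (Θ : ℂ → ℂ) : Submodule ℂ L2 where
  carrier := {g | ∃ h ∈ hardySpace, ∀ᵐ z ∂arcLength, g z = boundaryValue Θ z * h z}
  zero_mem' := by
    refine ⟨0, hardySpace.zero_mem, ?_⟩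
    filter_upwards [Lp.coeFn_zero ℂ 2 arcLength] with z hz
    rw [hz, Pi.zero_apply, mul_zero]
  add_mem' := by
    rintro f g ⟨h, hh, hf⟩ ⟨k, hk, hg⟩
    refine ⟨h + k, hardySpace.add_mem hh hk, ?_⟩
    filter_upwards [hf, hg, Lp.coeFn_add f g, Lp.coeFn_add h k] with z h1 h2 h3 h4
    rw [h3, h4, Pi.add_apply, Pi.add_apply, h1, h2, mul_add]
  smul_mem' := by
    rintro c f ⟨h, hh, hf⟩
    refine ⟨c • h, hardySpace.smul_mem c hh, ?_⟩
    filter_upwards [hf, Lp.coeFn_smul c f, Lp.coeFn_smul c h] with z h1 h2 h3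
    rw [h2, h3, Pi.smul_apply, Pi.smul_apply, h1, smul_eq_mul, smul_eq_mul]
    ring

/-- The model space `K_Θ = H² ∩ (Θ H²)^⊥`. -/
def modelSpace (Θ : ℂ → ℂ) : Submodule ℂ L2 :=
  hardySpace ⊓ (shiftedHardySpace Θ)ᗮ

theorem isClosed_modelSpace (Θ : ℂ → ℂ) : IsClosed (modelSpace Θ : Set L2) :=
  isClosed_hardySpace.inter (shiftedHardySpace Θ).isClosed_orthogonal

instance (Θ : ℂ → ℂ) : CompleteSpace (modelSpace Θ) :=
  (isClosed_modelSpace Θ).completeSpace_coe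

/-- `H^∞`, as a subspace of `L²`: the boundary functions of bounded analytic functions on the open
unit disc. -/
def hardyInfinity : Submodule ℂ L2 where
  carrier := {g | ∃ F : ℂ → ℂ, IsBoundedAnalytic F ∧ ∀ᵐ ζ ∂arcLength, HasRadialLimit F ζ (g ζ)}
  zero_mem' := by
    refine ⟨0, ⟨differentiableOn_const 0, 0, by simp⟩, ?_⟩
    filter_upwards [Lp.coeFn_zero ℂ 2 arcLength] with z hz
    rw [hz]
    exact tendsto_const_nhds
  add_mem' := by
    rintro f g ⟨F, ⟨hF, C, hC⟩, hf⟩ ⟨G, ⟨hG, D, hD⟩, hg⟩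
    refine ⟨F + G, ⟨hF.add hG, C + D, fun z hz =>
      (norm_add_le _ _).trans (add_le_add (hC z hz) (hD z hz))⟩, ?_⟩
    filter_upwards [hf, hg, Lp.coeFn_add f g] with z h1 h2 h3
    rw [h3]
    exact Tendsto.add h1 h2
  smul_mem' := by
    rintro c f ⟨F, ⟨hF, C, hC⟩, hf⟩
    refine ⟨c • F, ⟨hF.const_smul c, ‖c‖ * C, fun z hz => ?_⟩, ?_⟩
    · rw [Pi.smul_apply, norm_smul]
      exact mul_le_mul_of_nonneg_left (hC z hz) (norm_nonneg c)
    · filter_upwards [hf, Lp.coeFn_smul c f] with z h1 h2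
      rw [h2]
      exact Tendsto.const_smul h1 c

theorem memLp_top_of_mem_hardyInfinity {g : L2} (hg : g ∈ hardyInfinity) :
    MemLp g ∞ arcLength := by
  obtain ⟨F, ⟨_, C, hC⟩, h⟩ := hg
  refine MemLp.of_bound (Lp.aestronglyMeasurable g) C ?_
  filter_upwards [h] with ζ hζ
  refine le_of_tendsto hζ.norm ?_
  filter_upwards [Ioo_mem_nhdsLT (zero_lt_one' ℝ)] with r hr
  refine hC _ ?_
  rw [mem_ball_zero_iff, norm_mul, Circle.norm_coe, mul_one, Complex.norm_real,
    Real.norm_of_nonneg hr.1.le]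
  exact hr.2

/-- `K_Θ^∞ = H^∞ ∩ K_Θ`. -/
def boundedModelSpace (Θ : ℂ → ℂ) : Submodule ℂ L2 :=
  hardyInfinity ⊓ modelSpace Θ

theorem memLp_symbol_mul {Θ : ℂ → ℂ} (φ : L2) (f : boundedModelSpace Θ) :
    MemLp (fun z => φ z * (f : L2) z) 2 arcLength :=
  (memLp_top_of_mem_hardyInfinity f.2.1).mul' (Lp.memLp φ)

/-- The truncated Toeplitz operator `A_φ f = P_Θ (φ f)`, `f ∈ K_Θ^∞`, where `P_Θ` is the orthogonal
projection of `L²` onto `K_Θ`. -/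
def truncatedToeplitz (Θ : ℂ → ℂ) (φ : L2) : boundedModelSpace Θ →ₗ[ℂ] modelSpace Θ where
  toFun f := (modelSpace Θ).orthogonalProjectionOnto ((memLp_symbol_mul φ f).toLp _)
  map_add' f g := by
    rw [← map_add, ← MemLp.toLp_add]
    congr 1
    refine MemLp.toLp_congr _ _ ?_
    filter_upwards [Lp.coeFn_add (f : L2) (g : L2)] with z hz
    rw [Submodule.coe_add, hz, Pi.add_apply, Pi.add_apply, mul_add]
  map_smul' c f := by
    rw [RingHom.id_apply, ← map_smul, ← MemLp.toLp_const_smul]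
    congr 1
    refine MemLp.toLp_congr _ _ ?_
    filter_upwards [Lp.coeFn_smul c (f : L2)] with z hz
    rw [Submodule.coe_smul, hz, Pi.smul_apply, Pi.smul_apply, smul_eq_mul, smul_eq_mul]
    ring

/-- `‖A_φ‖ = sup {‖A_φ f‖ : f ∈ K_Θ^∞, ‖f‖ = 1}`, an element of `[0, ∞]`. -/
def toeplitzNorm (Θ : ℂ → ℂ) (φ : L2) : ℝ≥0∞ :=
  ⨆ f : boundedModelSpace Θ, ⨆ _ : ‖f‖ = 1, ‖truncatedToeplitz Θ φ f‖ₑ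

/-! ### The weighted measures -/

/-- `|(Θ(z) - Θ(ζ)) / (z - ζ)|²` for boundary points `ζ`, `z`. -/
def kernelSq (Θ : ℂ → ℂ) (ζ z : Circle) : ℝ :=
  ‖(boundaryValue Θ z - boundaryValue Θ ζ) / ((z : ℂ) - (ζ : ℂ))‖ ^ 2

/-- The measure `dν_ζ(z) = (1 / |Θ'(ζ)|) |(Θ(z) - Θ(ζ)) / (z - ζ)|² |dz| / 2π`. -/
def angularMeasure (Θ : ℂ → ℂ) (ζ : Circle) : Measure Circle :=
  arcLength.withDensity fun z => ENNReal.ofReal (1 / ‖angularDeriv Θ ζ‖ * kernelSq Θ ζ z)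

end

end TruncatedToeplitz

open TruncatedToeplitz

namespace TruncatedToeplitz

open scoped ComplexConjugate

/-! The estimate comes from testing `A_φ` on reproducing kernels and letting the base point tend
radially to `ζ`. For `μ` in the disc put `k_μ(z) = (1 - conj Θ(μ) Θ(z)) / (1 - conj μ z)`. It is
bounded and lies in `K_Θ`, so the quadratic form of `A_φ` and Cauchy–Schwarz give `|∫ φ |k_μ|²| ≤
‖A_φ‖ ‖k_μ‖²` (`IsInner.enorm_integral_mul_boundaryKernel_le`).

Let `μ = rζ`, `r → 1`. Existence of the angular derivative makes the radial difference quotients of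
`Θ` at `ζ` bounded by some `C`, and this yields the majorant `|k_{rζ}| ≤ 2|k_ζ| + C` almost
everywhere (`norm_boundaryKernel_le`). The explicit norms of `k_{rζ}` stay bounded, so Fatou puts
`k_ζ` in `L²`. Dominated convergence then handles bounded `φ`, and Fatou handles `φ ≥ 0`.

Since `|k_ζ|²` is the squared difference quotient of the statement, it remains to find `‖k_ζ‖²`. The
pairing of `k_{rζ}` with `k_ζ` is `conj Θ(ζ)` times the radial difference quotient of `Θ`, so its
limit has modulus `|Θ'(ζ)|` (`IsInner.integral_boundaryKernel_sq_eq`). This normalizes `ν_ζ`. It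
also shows `Θ'(ζ) ≠ 0`: otherwise `k_ζ = 0`, and `Θ` would be constant. Only radial limits of `Θ`
and `Θ'` at `ζ` are needed. -/

theorem integral_arcLength {E : Type*} [NormedAddCommGroup E] [NormedSpace ℝ E] (f : Circle → E) :
    ∫ z, f z ∂arcLength
      = ∫ x, f (AddCircle.homeomorphCircle' x)
          ∂(AddCircle.haarAddCircle : Measure (AddCircle (2 * Real.pi))) :=
  AddCircle.homeomorphCircle'.isClosedEmbedding.integral_map f

theorem homeomorphCircle'_eq_toCircle (x : AddCircle (2 * Real.pi)) :
    AddCircle.homeomorphCircle' x = AddCircle.toCircle x := by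
  induction x using QuotientAddGroup.induction_on with
  | H x =>
    rw [AddCircle.homeomorphCircle'_apply_mk, AddCircle.toCircle_apply_mk,
      div_self Real.two_pi_pos.ne', one_mul]

/-- A half-period shift reverses the sign of a suitable rotation-invariant integral: translating by
`π / n` turns the character into its negative. -/
theorem integral_pow_arcLength {n : ℕ} (hn : 0 < n) :
    ∫ z : Circle, (z : ℂ) ^ n ∂arcLength = 0 := by
  rw [integral_arcLength]
  have h : ∀ x : AddCircle (2 * Real.pi),
      ((AddCircle.homeomorphCircle' x : Circle) : ℂ) ^ n = fourier (n : ℤ) x := by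
    intro x
    rw [homeomorphCircle'_eq_toCircle, fourier_apply, natCast_zsmul, AddCircle.toCircle_nsmul,
      Circle.coe_pow]
  simp_rw [h]
  exact integral_eq_zero_of_add_right_eq_neg
    (fourier_add_half_inv_index (by exact_mod_cast hn.ne') Real.two_pi_pos)

instance : NullSingletonClass arcLength where
  measure_singleton ζ := by
    have : Nontrivial Circle :=
      ⟨⟨Circle.exp 0, Circle.exp Real.pi, fun h => by
        have := congrArg (fun z : Circle => (z : ℂ).re) h
        norm_num [Circle.coe_exp] at this⟩⟩
    have : Nontrivial (AddCircle (2 * Real.pi)) :=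
      AddCircle.homeomorphCircle'.toEquiv.nontrivial
    have h : (AddCircle.homeomorphCircle' ⁻¹' {ζ}) = {AddCircle.homeomorphCircle'.symm ζ} := by
      ext x
      rw [Set.mem_preimage, Set.mem_singleton_iff, Set.mem_singleton_iff,
        Homeomorph.eq_symm_apply]
    rw [arcLength, Measure.map_apply AddCircle.homeomorphCircle'.continuous.measurable
      (measurableSet_singleton ζ), h, measure_singleton]

/-- This discards the point `z = ζ`, where the denominator of the boundary kernel vanishes. -/
theorem ae_ne (ζ : Circle) : ∀ᵐ z ∂arcLength, z ≠ ζ :=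
  compl_mem_ae_iff.2 (measure_singleton ζ)

/-! ### Radial limits of analytic functions on the disc -/

theorem ofReal_mul_circle_mem_ball {r : ℝ} (hr : r ∈ Set.Ioo (0 : ℝ) 1) (z : Circle) :
    (r : ℂ) * (z : ℂ) ∈ Metric.ball (0 : ℂ) 1 := by
  rw [mem_ball_zero_iff, norm_mul, Circle.norm_coe, mul_one, Complex.norm_real,
    Real.norm_of_nonneg hr.1.le]
  exact hr.2

theorem continuous_dilate {G : ℂ → ℂ} (hG : DifferentiableOn ℂ G (Metric.ball 0 1)) {r : ℝ}
    (hr : r ∈ Set.Ioo (0 : ℝ) 1) : Continuous fun z : Circle => G (r * (z : ℂ)) := by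
  have h : Continuous fun z : Circle => (r : ℂ) * (z : ℂ) := by fun_prop
  exact hG.continuousOn.comp_continuous h (ofReal_mul_circle_mem_ball hr)

theorem Ioo_zero_one_mem_nhdsLT : Set.Ioo (0 : ℝ) 1 ∈ 𝓝[<] (1 : ℝ) :=
  Ioo_mem_nhdsLT zero_lt_one

theorem aestronglyMeasurable_of_radialLimit {G : ℂ → ℂ}
    (hG : DifferentiableOn ℂ G (Metric.ball 0 1)) {g : Circle → ℂ}
    (hg : ∀ᵐ z ∂arcLength, HasRadialLimit G z (g z)) : AEStronglyMeasurable g arcLength := by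
  obtain ⟨u, -, hu, hlim⟩ := exists_seq_strictMono_tendsto' (zero_lt_one' ℝ)
  refine aestronglyMeasurable_of_tendsto_ae atTop
    (f := fun n (z : Circle) => G (u n * (z : ℂ)))
    (fun n => (continuous_dilate hG (hu n)).aestronglyMeasurable) ?_
  filter_upwards [hg] with z hz
  exact hz.comp (tendsto_nhdsWithin_iff.2 ⟨hlim, .of_forall fun n => (hu n).2⟩)

theorem IsBoundedAnalytic.ae_norm_le {G : ℂ → ℂ} {C : ℝ}
    (hC : ∀ z ∈ Metric.ball (0 : ℂ) 1, ‖G z‖ ≤ C) {g : Circle → ℂ}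
    (hg : ∀ᵐ z ∂arcLength, HasRadialLimit G z (g z)) : ∀ᵐ z ∂arcLength, ‖g z‖ ≤ C := by
  filter_upwards [hg] with z hz
  refine le_of_tendsto hz.norm ?_
  filter_upwards [Ioo_zero_one_mem_nhdsLT] with r hr
  exact hC _ (ofReal_mul_circle_mem_ball hr z)

theorem memLp_of_radialLimit {G : ℂ → ℂ} (hG : IsBoundedAnalytic G) {g : Circle → ℂ}
    (hg : ∀ᵐ z ∂arcLength, HasRadialLimit G z (g z)) (p : ℝ≥0∞) : MemLp g p arcLength := by
  obtain ⟨C, hC⟩ := hG.2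
  exact .of_bound (aestronglyMeasurable_of_radialLimit hG.1 hg) C
    (IsBoundedAnalytic.ae_norm_le hC hg)

theorem integrable_of_memL2 (h : L2) : Integrable h arcLength :=
  memLp_one_iff_integrable.1 ((Lp.memLp h).mono_exponent one_le_two)

/-! ### Orthogonality relations between `H²` and `H^∞` -/

/-- On a circle of radius `r < 1` a function of `H²` is orthogonal to `z G`, by expanding `G` in
its Taylor series. -/
theorem integral_hardySpace_mul_dilate {h : L2} (hh : h ∈ hardySpace) {G : ℂ → ℂ}
    (hG : DifferentiableOn ℂ G (Metric.ball 0 1)) {r : ℝ} (hr : r ∈ Set.Ioo (0 : ℝ) 1) :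
    ∫ z : Circle, h z * ((z : ℂ) * G (r * (z : ℂ))) ∂arcLength = 0 := by
  set a : ℕ → ℂ := fun n => (n.factorial : ℂ)⁻¹ * iteratedDeriv n G 0 with ha
  have hsum : ∀ w ∈ Metric.ball (0 : ℂ) 1, HasSum (fun n => a n * w ^ n) (G w) := by
    intro w hw
    have h1 := Complex.hasSum_taylorSeries_on_ball hG hw
    refine Eq.subst (motive := fun s : ℕ → ℂ => HasSum s (G w)) (funext fun n => ?_) h1
    simp only [ha, sub_zero, smul_eq_mul]
    ring
  -- The extra factor `z` raises every exponent to `n + 1 > 0`, where the moments of `h` vanish.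
  set F : ℕ → Circle → ℂ := fun n z => a n * (r : ℂ) ^ n * ((z : ℂ) ^ (n + 1) * h z) with hF
  have hFi : ∀ n, Integrable (F n) arcLength := fun n =>
    (integrable_pow_mul (n + 1) h).const_mul _
  have hF0 : ∀ n, ∫ z, F n z ∂arcLength = 0 := fun n => by
    simp only [hF]
    rw [integral_const_mul, hh (n + 1) n.succ_pos, mul_zero]
  -- These integrals are `|a n * r ^ n| ∫ |h|`, so absolute convergence of the Taylor series at the
  -- interior point `r` suffices.
  have hnorm : Summable fun n => ∫ z, ‖F n z‖ ∂arcLength := by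
    have h1 : (r : ℂ) ∈ Metric.ball (0 : ℂ) 1 := by
      simpa using ofReal_mul_circle_mem_ball hr 1
    refine ((hsum _ h1).summable.norm.mul_right (∫ z, ‖h z‖ ∂arcLength)).congr fun n => ?_
    rw [← integral_const_mul]
    refine integral_congr_ae (ae_of_all _ fun z => ?_)
    simp only [hF, norm_mul, norm_pow, Circle.norm_coe, one_pow, one_mul]
  have key := hasSum_integral_of_summable_integral_norm hFi hnorm
  rw [funext hF0] at key
  have hz := key.unique hasSum_zero
  rw [← hz]
  refine integral_congr_ae (ae_of_all _ fun z => ?_)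
  have h2 := ((hsum _ (ofReal_mul_circle_mem_ball hr z)).mul_left ((z : ℂ) * h z)).tsum_eq
  dsimp only
  rw [show h z * ((z : ℂ) * G (r * (z : ℂ))) = (z : ℂ) * h z * G (r * (z : ℂ)) by ring, ← h2]
  refine tsum_congr fun n => ?_
  simp only [hF]
  ring

/-- If `h ∈ H²` and `g` is the boundary function of some `G ∈ H^∞`, then `∫ h z g = 0`. -/
theorem integral_hardySpace_mul {h : L2} (hh : h ∈ hardySpace) {G : ℂ → ℂ}
    (hG : IsBoundedAnalytic G) {g : Circle → ℂ}
    (hg : ∀ᵐ z ∂arcLength, HasRadialLimit G z (g z)) :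
    ∫ z : Circle, h z * ((z : ℂ) * g z) ∂arcLength = 0 := by
  obtain ⟨C, hC⟩ := hG.2
  have hlim : Tendsto (fun r : ℝ => ∫ z : Circle, h z * ((z : ℂ) * G (r * (z : ℂ))) ∂arcLength)
      (𝓝[<] 1) (𝓝 (∫ z : Circle, h z * ((z : ℂ) * g z) ∂arcLength)) := by
    refine tendsto_integral_filter_of_dominated_convergence (fun z => ‖h z‖ * C) ?_ ?_
      ((integrable_of_memL2 h).norm.mul_const C) ?_
    · filter_upwards [Ioo_zero_one_mem_nhdsLT] with r hr
      exact (Lp.aestronglyMeasurable h).mul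
        (continuous_circle_coe.mul (continuous_dilate hG.1 hr)).aestronglyMeasurable
    · filter_upwards [Ioo_zero_one_mem_nhdsLT] with r hr
      refine ae_of_all _ fun z => ?_
      rw [norm_mul, norm_mul, Circle.norm_coe, one_mul]
      exact mul_le_mul_of_nonneg_left (hC _ (ofReal_mul_circle_mem_ball hr z)) (norm_nonneg _)
    · filter_upwards [hg] with z hz
      exact tendsto_const_nhds.mul (tendsto_const_nhds.mul hz)
  refine tendsto_nhds_unique hlim (tendsto_const_nhds.congr' ?_)
  filter_upwards [Ioo_zero_one_mem_nhdsLT] with r hr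
  exact (integral_hardySpace_mul_dilate hh hG.1 hr).symm

/-- `∫ z g = 0` for the boundary function `g` of a function in `H^∞`. -/
theorem integral_coe_mul {G : ℂ → ℂ} (hG : IsBoundedAnalytic G) {g : Circle → ℂ}
    (hg : ∀ᵐ z ∂arcLength, HasRadialLimit G z (g z)) :
    ∫ z : Circle, (z : ℂ) * g z ∂arcLength = 0 := by
  have h1 : MemLp (fun _ : Circle => (1 : ℂ)) 2 arcLength := memLp_const 1
  have hmem : h1.toLp _ ∈ hardySpace := by
    intro n hn
    rw [← integral_pow_arcLength hn]
    refine integral_congr_ae ?_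
    filter_upwards [h1.coeFn_toLp] with z hz
    rw [hz, mul_one]
  rw [← integral_hardySpace_mul hmem hG hg]
  refine integral_congr_ae ?_
  filter_upwards [h1.coeFn_toLp] with z hz
  rw [hz, one_mul]

/-! ### Cauchy kernels, difference quotients and Cauchy's formula -/

theorem one_sub_conj_mul_ne_zero {μ z : ℂ} (hμ : ‖μ‖ < 1) (hz : ‖z‖ ≤ 1) :
    1 - conj μ * z ≠ 0 := by
  intro h
  have h1 : conj μ * z = 1 := (sub_eq_zero.1 h).symm
  have h2 := congrArg norm h1
  rw [norm_mul, RCLike.norm_conj, norm_one] at h2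
  nlinarith [norm_nonneg μ, norm_nonneg z]

theorem one_sub_norm_le_norm_one_sub {μ z : ℂ} (hz : ‖z‖ ≤ 1) :
    1 - ‖μ‖ ≤ ‖1 - conj μ * z‖ := by
  have h := norm_sub_norm_le (1 : ℂ) (conj μ * z)
  rw [norm_mul, RCLike.norm_conj, norm_one] at h
  nlinarith [norm_nonneg μ, norm_nonneg z]

theorem isBoundedAnalytic_cauchy {μ : ℂ} (hμ : ‖μ‖ < 1) :
    IsBoundedAnalytic fun z => (1 - conj μ * z)⁻¹ := by
  refine ⟨fun z hz => ?_, (1 - ‖μ‖)⁻¹, fun z hz => ?_⟩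
  · rw [mem_ball_zero_iff] at hz
    refine DifferentiableAt.differentiableWithinAt ?_
    exact DifferentiableAt.inv (by fun_prop) (one_sub_conj_mul_ne_zero hμ hz.le)
  · rw [mem_ball_zero_iff] at hz
    rw [norm_inv]
    exact inv_anti₀ (sub_pos.2 hμ) (one_sub_norm_le_norm_one_sub hz.le)

theorem IsBoundedAnalytic.mul {F G : ℂ → ℂ} (hF : IsBoundedAnalytic F)
    (hG : IsBoundedAnalytic G) : IsBoundedAnalytic fun z => F z * G z := by
  obtain ⟨C, hC⟩ := hF.2
  obtain ⟨D, hD⟩ := hG.2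
  refine ⟨hF.1.mul hG.1, C * D, fun z hz => ?_⟩
  rw [norm_mul]
  exact mul_le_mul (hC z hz) (hD z hz) (norm_nonneg _) ((norm_nonneg _).trans (hC z hz))

theorem isBoundedAnalytic_const (c : ℂ) : IsBoundedAnalytic fun _ => c :=
  ⟨differentiableOn_const c, ‖c‖, fun _ _ => le_rfl⟩

theorem IsBoundedAnalytic.sub {F G : ℂ → ℂ} (hF : IsBoundedAnalytic F)
    (hG : IsBoundedAnalytic G) : IsBoundedAnalytic fun z => F z - G z := by
  obtain ⟨C, hC⟩ := hF.2
  obtain ⟨D, hD⟩ := hG.2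
  exact ⟨hF.1.sub hG.1, C + D, fun z hz =>
    (norm_sub_le _ _).trans (add_le_add (hC z hz) (hD z hz))⟩

theorem hasRadialLimit_of_continuousAt {F : ℂ → ℂ} {ζ : Circle} (h : ContinuousAt F (ζ : ℂ)) :
    HasRadialLimit F ζ (F ζ) := by
  have hc : Continuous fun r : ℝ => (r : ℂ) * (ζ : ℂ) := by fun_prop
  have h1 := hc.tendsto 1
  simp only [Complex.ofReal_one, one_mul] at h1
  exact h.tendsto.comp (h1.mono_left nhdsWithin_le_nhds)

theorem hasRadialLimit_cauchy {μ : ℂ} (hμ : ‖μ‖ < 1) (ζ : Circle) :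
    HasRadialLimit (fun z => (1 - conj μ * z)⁻¹) ζ (1 - conj μ * (ζ : ℂ))⁻¹ := by
  refine hasRadialLimit_of_continuousAt (F := fun z => (1 - conj μ * z)⁻¹) ?_
  exact ContinuousAt.inv₀ (by fun_prop) (one_sub_conj_mul_ne_zero hμ (Circle.norm_coe ζ).le)

/-- The difference quotient of a bounded analytic function is bounded analytic. -/
theorem IsBoundedAnalytic.dslope {F : ℂ → ℂ} (hF : IsBoundedAnalytic F) {μ : ℂ} (hμ : ‖μ‖ < 1) :
    IsBoundedAnalytic (dslope F μ) := by
  have hμ' : μ ∈ Metric.ball (0 : ℂ) 1 := by simpa using hμ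
  have hd : DifferentiableOn ℂ (_root_.dslope F μ) (Metric.ball 0 1) :=
    (Complex.differentiableOn_dslope (Metric.isOpen_ball.mem_nhds hμ')).2 hF.1
  obtain ⟨C, hC⟩ := hF.2
  -- The intermediate radius separates two regimes: compactness bounds the quotient on `|z| ≤ ρ`,
  -- and beyond it the denominator is at least `ρ - |μ|`.
  obtain ⟨ρ, hρ, hρ1⟩ := exists_between hμ
  have hsub : Metric.closedBall (0 : ℂ) ρ ⊆ Metric.ball 0 1 :=
    Metric.closedBall_subset_ball hρ1
  obtain ⟨B, hB⟩ := (isCompact_closedBall (0 : ℂ) ρ).exists_bound_of_continuousOn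
    (hd.continuousOn.mono hsub)
  refine ⟨hd, max B (2 * C / (ρ - ‖μ‖)), fun z hz => ?_⟩
  rcases le_or_gt ‖z‖ ρ with h | h
  · exact (hB z (by simpa using h)).trans (le_max_left _ _)
  · refine le_trans ?_ (le_max_right _ _)
    have hne : z ≠ μ := by
      rintro rfl
      exact absurd h (not_lt.2 hρ.le)
    rw [dslope_of_ne _ hne, slope_def_field, norm_div]
    have h1 : ‖F z - F μ‖ ≤ 2 * C :=
      (norm_sub_le _ _).trans (by linarith [hC z hz, hC μ hμ'])
    have h2 : ρ - ‖μ‖ ≤ ‖z - μ‖ := by linarith [norm_sub_norm_le z μ]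
    exact div_le_div₀ ((norm_nonneg _).trans h1) h1 (sub_pos.2 hρ) h2

theorem HasRadialLimit.dslope {F : ℂ → ℂ} {ζ : Circle} {l μ : ℂ} (h : HasRadialLimit F ζ l)
    (hμ : ‖μ‖ < 1) : HasRadialLimit (dslope F μ) ζ ((l - F μ) / ((ζ : ℂ) - μ)) := by
  have hne : (ζ : ℂ) - μ ≠ 0 := by
    rw [sub_ne_zero]
    rintro rfl
    exact hμ.ne (Circle.norm_coe ζ)
  have hc : Continuous fun r : ℝ => (r : ℂ) * (ζ : ℂ) := by fun_prop
  have h1 := hc.tendsto 1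
  simp only [Complex.ofReal_one, one_mul] at h1
  have h2 := h1.mono_left (nhdsWithin_le_nhds (s := Set.Iio 1))
  have h3 : Tendsto (fun r : ℝ => (F (r * (ζ : ℂ)) - F μ) / ((r : ℂ) * (ζ : ℂ) - μ)) (𝓝[<] 1)
      (𝓝 ((l - F μ) / ((ζ : ℂ) - μ))) :=
    (Tendsto.sub h tendsto_const_nhds).div (h2.sub tendsto_const_nhds) hne
  refine h3.congr' ?_
  filter_upwards [h2.eventually_ne (sub_ne_zero.1 hne)] with r hr
  rw [dslope_of_ne _ hr, slope_def_field]

theorem circle_conj_mul (z : Circle) : conj (z : ℂ) * z = 1 := by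
  rw [mul_comm, Complex.mul_conj, Complex.normSq_eq_norm_sq, Circle.norm_coe]
  simp

/-- On the circle `z⁻¹ = conj z`. This turns `z` times a difference quotient, whose mean is zero,
into an expression with the conjugated Cauchy kernel. -/
theorem circle_mul_div_sub {μ : ℂ} (hμ : ‖μ‖ < 1) (z : Circle) (w : ℂ) :
    (z : ℂ) * (w / ((z : ℂ) - μ)) = w / (1 - μ * conj (z : ℂ)) := by
  have hne : (z : ℂ) - μ ≠ 0 := by
    rw [sub_ne_zero]
    rintro rfl
    exact hμ.ne (Circle.norm_coe z)
  have hz : (1 : ℂ) - μ * conj (z : ℂ) = ((z : ℂ) - μ) * conj (z : ℂ) := by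
    rw [sub_mul, mul_comm (z : ℂ), circle_conj_mul]
  have hz0 : conj (z : ℂ) ≠ 0 := by simp
  rw [hz]
  field_simp
  rw [mul_comm (z : ℂ), mul_assoc, mul_comm (z : ℂ), circle_conj_mul, mul_one]

theorem continuous_cauchy {μ : ℂ} (hμ : ‖μ‖ < 1) :
    Continuous fun z : Circle => (1 - conj μ * (z : ℂ))⁻¹ :=
  Continuous.inv₀ (by fun_prop) fun z => one_sub_conj_mul_ne_zero hμ (Circle.norm_coe z).le

theorem conj_one_sub_conj_mul (μ z : ℂ) : conj (1 - conj μ * z) = 1 - μ * conj z := by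
  simp

/-- The geometric identity `1 / (1 - u) = 1 + u / (1 - u)` with `u = conj μ * z` leaves the constant
1 plus a function in `z H^∞`, which has mean zero. Conjugation gives the stated form. -/
theorem integral_cauchy {μ : ℂ} (hμ : ‖μ‖ < 1) :
    ∫ z : Circle, (1 - μ * conj (z : ℂ))⁻¹ ∂arcLength = 1 := by
  have h1 : ∫ z : Circle, (1 - conj μ * (z : ℂ))⁻¹ ∂arcLength = 1 := by
    have h2 : ∀ z : Circle, (1 - conj μ * (z : ℂ))⁻¹
        = 1 + conj μ * ((z : ℂ) * (1 - conj μ * (z : ℂ))⁻¹) := fun z => by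
      have := one_sub_conj_mul_ne_zero hμ (Circle.norm_coe z).le
      field_simp
      ring
    have hi : Integrable (fun z : Circle => (z : ℂ) * (1 - conj μ * (z : ℂ))⁻¹) arcLength :=
      memLp_one_iff_integrable.1 (.of_bound
        (continuous_circle_coe.mul (continuous_cauchy hμ)).aestronglyMeasurable (1 - ‖μ‖)⁻¹
        (ae_of_all _ fun z => by
          rw [norm_mul, Circle.norm_coe, one_mul, norm_inv]
          exact inv_anti₀ (sub_pos.2 hμ) (one_sub_norm_le_norm_one_sub (Circle.norm_coe z).le)))
    rw [integral_congr_ae (ae_of_all _ h2), integral_add (integrable_const _) (hi.const_mul _), integral_const_mul,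
      integral_coe_mul (isBoundedAnalytic_cauchy hμ)
        (ae_of_all _ fun z => hasRadialLimit_cauchy hμ z)]
    simp
  have h3 := congrArg (starRingEnd ℂ) h1
  rw [← integral_conj, map_one] at h3
  refine Eq.trans ?_ h3
  refine integral_congr_ae (ae_of_all _ fun z => ?_)
  dsimp only
  rw [map_inv₀, conj_one_sub_conj_mul]

/-- Cauchy's formula for `H^∞`, with boundary values. -/
theorem integral_div_cauchy {F : ℂ → ℂ} (hF : IsBoundedAnalytic F) {f : Circle → ℂ}
    (hf : ∀ᵐ z ∂arcLength, HasRadialLimit F z (f z)) {μ : ℂ} (hμ : ‖μ‖ < 1) :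
    ∫ z : Circle, f z / (1 - μ * conj (z : ℂ)) ∂arcLength = F μ := by
  have hc : Continuous fun z : Circle => (1 - μ * conj (z : ℂ))⁻¹ := by
    have := Complex.continuous_conj.comp (continuous_cauchy hμ)
    simpa [Function.comp_def] using this
  have hb : ∀ z : Circle, ‖(1 - μ * conj (z : ℂ))⁻¹‖ ≤ (1 - ‖μ‖)⁻¹ := fun z => by
    rw [← conj_one_sub_conj_mul, norm_inv, RCLike.norm_conj]
    exact inv_anti₀ (sub_pos.2 hμ) (one_sub_norm_le_norm_one_sub (Circle.norm_coe z).le)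
  have hL : MemLp (fun z : Circle => (1 - μ * conj (z : ℂ))⁻¹) ∞ arcLength :=
    .of_bound hc.aestronglyMeasurable _ (ae_of_all _ hb)
  have hi1 : Integrable (fun z : Circle => (1 - μ * conj (z : ℂ))⁻¹) arcLength :=
    memLp_one_iff_integrable.1 (hL.mono_exponent le_top)
  have hi2 : Integrable (fun z : Circle => f z / (1 - μ * conj (z : ℂ))) arcLength := by
    refine memLp_one_iff_integrable.1 ?_
    simp_rw [div_eq_mul_inv]
    exact hL.mul' (memLp_of_radialLimit hF hf 1)
  -- After the rewriting below, this says that `(f - F μ) / (1 - μ * conj z)` has mean zero.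
  have h0 := integral_coe_mul (hF.dslope hμ) (hf.mono fun z hz => hz.dslope hμ)
  simp_rw [circle_mul_div_sub hμ, sub_div] at h0
  rw [integral_sub hi2 (by simpa [div_eq_mul_inv] using hi1.const_mul (F μ)), sub_eq_zero] at h0
  rw [h0]
  simp_rw [div_eq_mul_inv]
  rw [integral_const_mul, integral_cauchy hμ, mul_one]

/-! ### Reproducing kernels of the model space -/

theorem IsInner.ae_boundaryValue {Θ : ℂ → ℂ} (hΘ : IsInner Θ) :
    ∀ᵐ z ∂arcLength, HasRadialLimit Θ z (boundaryValue Θ z) ∧ ‖boundaryValue Θ z‖ = 1 := by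
  filter_upwards [hΘ.2] with z ⟨l, hl, hz⟩
  rw [hz.boundaryValue_eq]
  exact ⟨hz, hl⟩

theorem IsInner.ae_hasRadialLimit {Θ : ℂ → ℂ} (hΘ : IsInner Θ) :
    ∀ᵐ z ∂arcLength, HasRadialLimit Θ z (boundaryValue Θ z) :=
  hΘ.ae_boundaryValue.mono fun _ h => h.1

theorem IsInner.aestronglyMeasurable {Θ : ℂ → ℂ} (hΘ : IsInner Θ) :
    AEStronglyMeasurable (fun z : Circle => boundaryValue Θ z) arcLength :=
  aestronglyMeasurable_of_radialLimit hΘ.1.1 hΘ.ae_hasRadialLimit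

theorem isBoundedAnalytic_pow (n : ℕ) : IsBoundedAnalytic fun z => z ^ n := by
  refine ⟨by fun_prop, 1, fun z hz => ?_⟩
  rw [mem_ball_zero_iff] at hz
  rw [norm_pow]
  exact pow_le_one₀ (norm_nonneg _) hz.le

theorem toLp_mem_hardySpace {F : ℂ → ℂ} (hF : IsBoundedAnalytic F) {f : Circle → ℂ}
    (hf : ∀ᵐ z ∂arcLength, HasRadialLimit F z (f z)) :
    (memLp_of_radialLimit hF hf 2).toLp f ∈ hardySpace := by
  rintro (_ | n) hn
  · exact absurd hn (lt_irrefl 0)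
  rw [← integral_coe_mul ((isBoundedAnalytic_pow n).mul hF) (g := fun z => (z : ℂ) ^ n * f z)
    (hf.mono fun z hz => Tendsto.mul
      (hasRadialLimit_of_continuousAt (F := fun z => z ^ n) (by fun_prop)) hz)]
  refine integral_congr_ae ?_
  filter_upwards [(memLp_of_radialLimit hF hf 2).coeFn_toLp] with z hz
  rw [hz]
  ring

theorem toLp_mem_hardyInfinity {F : ℂ → ℂ} (hF : IsBoundedAnalytic F) {f : Circle → ℂ}
    (hf : ∀ᵐ z ∂arcLength, HasRadialLimit F z (f z)) :
    (memLp_of_radialLimit hF hf 2).toLp f ∈ hardyInfinity := by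
  refine ⟨F, hF, ?_⟩
  filter_upwards [(memLp_of_radialLimit hF hf 2).coeFn_toLp, hf] with z h1 h2
  rwa [h1]

/-- The function `z ↦ (1 - w̄ Θ(z)) / (1 - μ̄ z)` on the unit circle. For `w = Θ(μ)` it is the
reproducing kernel of the model space at `μ`. -/
noncomputable def boundaryKernel (Θ : ℂ → ℂ) (w μ : ℂ) (z : Circle) : ℂ :=
  (1 - conj w * boundaryValue Θ z) / (1 - conj μ * (z : ℂ))

theorem isBoundedAnalytic_kernel {Θ : ℂ → ℂ} (hΘ : IsBoundedAnalytic Θ) (w : ℂ) {μ : ℂ}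
    (hμ : ‖μ‖ < 1) : IsBoundedAnalytic fun z => (1 - conj w * Θ z) * (1 - conj μ * z)⁻¹ :=
  ((isBoundedAnalytic_const 1).sub ((isBoundedAnalytic_const (conj w)).mul hΘ)).mul
    (isBoundedAnalytic_cauchy hμ)

theorem IsInner.ae_hasRadialLimit_kernel {Θ : ℂ → ℂ} (hΘ : IsInner Θ) (w : ℂ) {μ : ℂ}
    (hμ : ‖μ‖ < 1) : ∀ᵐ z ∂arcLength,
      HasRadialLimit (fun z => (1 - conj w * Θ z) * (1 - conj μ * z)⁻¹) z
        (boundaryKernel Θ w μ z) := by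
  filter_upwards [hΘ.ae_hasRadialLimit] with z hz
  exact (tendsto_const_nhds.sub (tendsto_const_nhds.mul hz)).mul (hasRadialLimit_cauchy hμ z)

/-- There is no condition on `μ`, so this also covers base points on the circle, where boundedness
may fail. -/
theorem IsInner.aestronglyMeasurable_boundaryKernel {Θ : ℂ → ℂ} (hΘ : IsInner Θ) (w μ : ℂ) :
    AEStronglyMeasurable (boundaryKernel Θ w μ) arcLength := by
  unfold boundaryKernel
  simp_rw [div_eq_mul_inv]
  refine (aestronglyMeasurable_const.sub (aestronglyMeasurable_const.mul
    hΘ.aestronglyMeasurable)).mul (Measurable.aestronglyMeasurable ?_)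
  exact (Continuous.measurable (by fun_prop : Continuous fun z : Circle =>
    1 - conj μ * (z : ℂ))).inv

theorem IsInner.memLp_boundaryKernel {Θ : ℂ → ℂ} (hΘ : IsInner Θ) (w : ℂ) {μ : ℂ}
    (hμ : ‖μ‖ < 1) (p : ℝ≥0∞) : MemLp (boundaryKernel Θ w μ) p arcLength :=
  memLp_of_radialLimit (isBoundedAnalytic_kernel hΘ.1 w hμ) (hΘ.ae_hasRadialLimit_kernel w hμ) p

/-- The kernel functions are orthogonal to `Θ H²`. -/
theorem IsInner.integral_mul_conj_boundaryKernel {Θ : ℂ → ℂ} (hΘ : IsInner Θ) {h : L2}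
    (hh : h ∈ hardySpace) {μ : ℂ} (hμ : ‖μ‖ < 1) :
    ∫ z, boundaryValue Θ z * h z * conj (boundaryKernel Θ (Θ μ) μ z) ∂arcLength = 0 := by
  rw [← integral_hardySpace_mul hh (hΘ.1.dslope hμ)
    (hΘ.ae_hasRadialLimit.mono fun z hz => hz.dslope hμ)]
  refine integral_congr_ae ?_
  filter_upwards [hΘ.ae_boundaryValue] with z hz
  -- As `|Θ| = 1`, the product `Θ * conj k_μ` equals `z` times the difference quotient of `Θ` at
  -- `μ`.
  have h1 : boundaryValue Θ z * conj (boundaryValue Θ z) = 1 := by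
    rw [Complex.mul_conj, Complex.normSq_eq_norm_sq, hz.2]
    simp
  rw [circle_mul_div_sub hμ, boundaryKernel, map_div₀, conj_one_sub_conj_mul,
    conj_one_sub_conj_mul]
  linear_combination (- h z * Θ μ / (1 - μ * conj (z : ℂ))) * h1

/-- The reproducing property. Split `conj k_μ` into the conjugated Cauchy kernel and a multiple of
the conjugate of `Θ` times the Cauchy kernel. The first part evaluates `k_lam` at `μ` by Cauchy's
formula; the second contributes nothing because `k_lam` is orthogonal to `Θ H²`. -/
theorem IsInner.integral_conj_boundaryKernel_mul {Θ : ℂ → ℂ} (hΘ : IsInner Θ) {lam μ : ℂ}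
    (hlam : ‖lam‖ < 1) (hμ : ‖μ‖ < 1) :
    ∫ z, conj (boundaryKernel Θ (Θ μ) μ z) * boundaryKernel Θ (Θ lam) lam z ∂arcLength
      = (1 - conj (Θ lam) * Θ μ) / (1 - conj lam * μ) := by
  have h1 := integral_div_cauchy (isBoundedAnalytic_kernel hΘ.1 (Θ lam) hlam)
    (hΘ.ae_hasRadialLimit_kernel (Θ lam) hlam) hμ
  have hc := memLp_of_radialLimit (isBoundedAnalytic_cauchy hμ)
    (ae_of_all _ fun z => hasRadialLimit_cauchy hμ z) 2
  have h2 := hΘ.integral_mul_conj_boundaryKernel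
    (toLp_mem_hardySpace (isBoundedAnalytic_cauchy hμ)
      (ae_of_all _ fun z => hasRadialLimit_cauchy hμ z)) hlam
  replace h2 := congrArg (starRingEnd ℂ) h2
  rw [← integral_conj, map_zero] at h2
  have hk := hΘ.memLp_boundaryKernel (Θ lam) hlam 2
  have hθ := memLp_of_radialLimit hΘ.1 hΘ.ae_hasRadialLimit ∞
  have e1 : ∀ z : Circle, conj (boundaryKernel Θ (Θ μ) μ z) * boundaryKernel Θ (Θ lam) lam z
      = boundaryKernel Θ (Θ lam) lam z / (1 - μ * conj (z : ℂ))
        - Θ μ * (conj (boundaryValue Θ z * (1 - conj μ * (z : ℂ))⁻¹)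
          * boundaryKernel Θ (Θ lam) lam z) := fun z => by
    rw [boundaryKernel, map_div₀, conj_one_sub_conj_mul, conj_one_sub_conj_mul, map_mul,
      map_inv₀, conj_one_sub_conj_mul]
    ring
  have i1 : Integrable (fun z : Circle => boundaryKernel Θ (Θ lam) lam z
      / (1 - μ * conj (z : ℂ))) arcLength := by
    refine (hc.star.integrable_mul hk).congr (ae_of_all _ fun z => ?_)
    simp only [Pi.mul_apply, Pi.star_apply, RCLike.star_def]
    rw [map_inv₀, conj_one_sub_conj_mul]
    ring
  have i2 : Integrable (fun z : Circle => conj (boundaryValue Θ z * (1 - conj μ * (z : ℂ))⁻¹)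
      * boundaryKernel Θ (Θ lam) lam z) arcLength := by
    exact (MemLp.star (hc.mul' hθ : MemLp _ 2 _)).integrable_mul hk
  rw [integral_congr_ae (ae_of_all _ e1), integral_sub i1 (i2.const_mul _), integral_const_mul, h1]
  have h3 : ∫ z : Circle, conj (boundaryValue Θ z * (1 - conj μ * (z : ℂ))⁻¹)
      * boundaryKernel Θ (Θ lam) lam z ∂arcLength = 0 := by
    rw [← h2]
    refine integral_congr_ae ?_
    filter_upwards [hc.coeFn_toLp] with z hz
    rw [hz, map_mul (starRingEnd ℂ) (_ * _), Complex.conj_conj]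
  rw [h3]
  ring

theorem IsInner.integral_norm_boundaryKernel_sq {Θ : ℂ → ℂ} (hΘ : IsInner Θ) {μ : ℂ}
    (hμ : ‖μ‖ < 1) :
    ∫ z, ‖boundaryKernel Θ (Θ μ) μ z‖ ^ 2 ∂arcLength = (1 - ‖Θ μ‖ ^ 2) / (1 - ‖μ‖ ^ 2) := by
  have h := hΘ.integral_conj_boundaryKernel_mul hμ hμ
  simp_rw [Complex.conj_mul'] at h
  exact_mod_cast h

theorem IsInner.exists_boundedModelSpace_kernel {Θ : ℂ → ℂ} (hΘ : IsInner Θ) {μ : ℂ}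
    (hμ : ‖μ‖ < 1) : ∃ k : boundedModelSpace Θ,
      ∀ᵐ z ∂arcLength, (k : L2) z = boundaryKernel Θ (Θ μ) μ z := by
  have hk := isBoundedAnalytic_kernel hΘ.1 (Θ μ) hμ
  have hr := hΘ.ae_hasRadialLimit_kernel (Θ μ) hμ
  have hae := (memLp_of_radialLimit hk hr 2).coeFn_toLp
  refine ⟨⟨(memLp_of_radialLimit hk hr 2).toLp _, toLp_mem_hardyInfinity hk hr,
    toLp_mem_hardySpace hk hr, ?_⟩, hae⟩
  rw [SetLike.mem_coe, Submodule.mem_orthogonal']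
  rintro g ⟨h, hh, hg⟩
  rw [L2.inner_def, ← hΘ.integral_mul_conj_boundaryKernel hh hμ]
  refine integral_congr_ae ?_
  filter_upwards [hae, hg] with z h1 h2
  rw [h1, h2, RCLike.inner_apply]

/-! ### The quadratic form of a truncated Toeplitz operator -/

theorem enorm_truncatedToeplitz_le (Θ : ℂ → ℂ) (φ : L2) (f : boundedModelSpace Θ) :
    ‖truncatedToeplitz Θ φ f‖ₑ ≤ toeplitzNorm Θ φ * ‖f‖ₑ := by
  rcases eq_or_ne f 0 with rfl | hf
  · rw [map_zero, ← ofReal_norm, norm_zero, ENNReal.ofReal_zero]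
    exact zero_le
  have hf0 : ‖f‖ ≠ 0 := norm_ne_zero_iff.2 hf
  have hc : ((‖f‖ : ℂ)) ≠ 0 := by exact_mod_cast hf0
  set g : boundedModelSpace Θ := ((‖f‖ : ℂ))⁻¹ • f with hg
  have hg1 : ‖g‖ = 1 := by
    rw [hg, norm_smul, norm_inv, Complex.norm_real, norm_norm, inv_mul_cancel₀ hf0]
  have hfg : f = (‖f‖ : ℂ) • g := by rw [hg, smul_inv_smul₀ hc]
  have hle : ‖truncatedToeplitz Θ φ g‖ₑ ≤ toeplitzNorm Θ φ :=
    le_iSup₂_of_le g hg1 le_rfl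
  calc ‖truncatedToeplitz Θ φ f‖ₑ = ‖(‖f‖ : ℂ) • truncatedToeplitz Θ φ g‖ₑ := by
        rw [← map_smul, ← hfg]
    _ = ‖f‖ₑ * ‖truncatedToeplitz Θ φ g‖ₑ := by
        rw [enorm_smul]
        congr 1
        rw [← ofReal_norm, ← ofReal_norm, Complex.norm_real, norm_norm]
    _ ≤ toeplitzNorm Θ φ * ‖f‖ₑ := by
        rw [mul_comm]
        exact mul_le_mul_left hle _

/-- The quadratic form of a truncated Toeplitz operator. -/
theorem inner_truncatedToeplitz (Θ : ℂ → ℂ) (φ : L2) (f : boundedModelSpace Θ) :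
    inner ℂ (⟨f, f.2.2⟩ : modelSpace Θ) (truncatedToeplitz Θ φ f)
      = ∫ z, φ z * ((‖(f : L2) z‖ ^ 2 : ℝ) : ℂ) ∂arcLength := by
  -- The projection drops out of the pairing because `f` already lies in `K_Θ`.
  rw [truncatedToeplitz, LinearMap.coe_mk, AddHom.coe_mk,
    Submodule.inner_orthogonalProjectionOnto_eq_of_mem_left, L2.inner_def]
  refine integral_congr_ae ?_
  filter_upwards [(memLp_symbol_mul φ f).coeFn_toLp] with z hz
  rw [hz, RCLike.inner_apply, mul_assoc, Complex.mul_conj']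
  norm_cast

/-- Cauchy–Schwarz for the quadratic form; the last factor is `‖f‖²`. -/
theorem enorm_integral_mul_norm_sq_le (Θ : ℂ → ℂ) (φ : L2) (f : boundedModelSpace Θ) :
    ‖∫ z, φ z * ((‖(f : L2) z‖ ^ 2 : ℝ) : ℂ) ∂arcLength‖ₑ
      ≤ toeplitzNorm Θ φ * ENNReal.ofReal (∫ z, ‖(f : L2) z‖ ^ 2 ∂arcLength) := by
  have hnorm : ENNReal.ofReal (∫ z, ‖(f : L2) z‖ ^ 2 ∂arcLength) = ‖f‖ₑ * ‖f‖ₑ := by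
    have h1 : ((∫ z, ‖(f : L2) z‖ ^ 2 ∂arcLength : ℝ) : ℂ) = ((‖f‖ ^ 2 : ℝ) : ℂ) := by
      have h2 := inner_self_eq_norm_sq_to_K (𝕜 := ℂ) (f : L2)
      rw [L2.inner_def] at h2
      rw [← integral_complex_ofReal, Complex.ofReal_pow]
      refine Eq.trans (integral_congr_ae (ae_of_all _ fun z => ?_)) h2
      dsimp only
      rw [RCLike.inner_apply, Complex.mul_conj']
      norm_cast
    rw [Complex.ofReal_inj.1 h1, pow_two, ENNReal.ofReal_mul (norm_nonneg _), ofReal_norm]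
  rw [hnorm, ← inner_truncatedToeplitz, ← mul_assoc, mul_comm]
  have h3 := norm_inner_le_norm (𝕜 := ℂ) (⟨f, f.2.2⟩ : modelSpace Θ) (truncatedToeplitz Θ φ f)
  have h4 : ‖(⟨f, f.2.2⟩ : modelSpace Θ)‖ = ‖f‖ := rfl
  rw [h4] at h3
  calc _ ≤ ‖f‖ₑ * ‖truncatedToeplitz Θ φ f‖ₑ := by
        rw [← ofReal_norm, ← ofReal_norm, ← ofReal_norm, ← ENNReal.ofReal_mul (norm_nonneg _)]
        exact ENNReal.ofReal_le_ofReal h3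
    _ ≤ _ := by
        gcongr
        exact enorm_truncatedToeplitz_le Θ φ f

theorem IsInner.enorm_integral_mul_boundaryKernel_le {Θ : ℂ → ℂ} (hΘ : IsInner Θ) (φ : L2) {μ : ℂ}
    (hμ : ‖μ‖ < 1) :
    ‖∫ z, φ z * ((‖boundaryKernel Θ (Θ μ) μ z‖ ^ 2 : ℝ) : ℂ) ∂arcLength‖ₑ
      ≤ toeplitzNorm Θ φ
        * ENNReal.ofReal (∫ z, ‖boundaryKernel Θ (Θ μ) μ z‖ ^ 2 ∂arcLength) := by
  obtain ⟨k, hk⟩ := hΘ.exists_boundedModelSpace_kernel hμ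
  have h := enorm_integral_mul_norm_sq_le Θ φ k
  rwa [integral_congr_ae (g := fun z => φ z * ((‖boundaryKernel Θ (Θ μ) μ z‖ ^ 2 : ℝ) : ℂ))
      (hk.mono fun z hz => by dsimp only; rw [hz]),
    integral_congr_ae (g := fun z => ‖boundaryKernel Θ (Θ μ) μ z‖ ^ 2)
      (hk.mono fun z hz => by dsimp only; rw [hz])] at h

/-! ### Radial behaviour at a point with finite angular derivative -/

theorem norm_boundaryValue_of_mem_angularSet {Θ : ℂ → ℂ} {ζ : Circle} (hζ : ζ ∈ angularSet Θ) :
    ‖boundaryValue Θ ζ‖ = 1 := by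
  obtain ⟨⟨w, hw, h⟩, -⟩ := hζ
  rw [h.hasRadialLimit.boundaryValue_eq, hw]

theorem hasRadialLimit_of_mem_angularSet {Θ : ℂ → ℂ} {ζ : Circle} (hζ : ζ ∈ angularSet Θ) :
    HasRadialLimit Θ ζ (boundaryValue Θ ζ) := by
  obtain ⟨⟨w, hw, h⟩, -⟩ := hζ
  rw [h.hasRadialLimit.boundaryValue_eq]
  exact h.hasRadialLimit

theorem hasRadialLimit_deriv_of_mem_angularSet {Θ : ℂ → ℂ} {ζ : Circle} (hζ : ζ ∈ angularSet Θ) :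
    HasRadialLimit (deriv Θ) ζ (angularDeriv Θ ζ) := by
  obtain ⟨-, d, h⟩ := hζ
  rw [angularDeriv, h.hasRadialLimit.boundaryValue_eq]
  exact h.hasRadialLimit

/-- Along the radius, difference quotients at the boundary point converge to the limit of the
derivative. -/
theorem tendsto_radial_slope {F : ℂ → ℂ} (hF : DifferentiableOn ℂ F (Metric.ball 0 1))
    {ζ : Circle} {w d : ℂ} (hw : HasRadialLimit F ζ w) (hd : HasRadialLimit (deriv F) ζ d) :
    Tendsto (fun r : ℝ => (w - F (r * (ζ : ℂ))) / (1 - r)) (𝓝[<] 1) (𝓝 (ζ * d)) := by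
  -- Assigning the value `w` from `r = 1` on makes `g` left-continuous at 1, so the limit of its
  -- derivative is its one-sided derivative there.
  set g : ℝ → ℂ := fun r => if r < 1 then F (r * (ζ : ℂ)) else w with hg
  have hgd : ∀ r ∈ Set.Ioo (0 : ℝ) 1, HasDerivAt g (ζ * deriv F (r * (ζ : ℂ))) r := by
    intro r hr
    have h1 : HasDerivAt F (deriv F (r * (ζ : ℂ))) (r * (ζ : ℂ)) :=
      (hF.differentiableAt
        (Metric.isOpen_ball.mem_nhds (ofReal_mul_circle_mem_ball hr ζ))).hasDerivAt
    have h2 : HasDerivAt (fun t : ℝ => (t : ℂ) * (ζ : ℂ)) (ζ : ℂ) r := by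
      simpa using (Complex.ofRealCLM.hasDerivAt (x := r)).mul_const (ζ : ℂ)
    have h3 := h1.comp r h2
    rw [mul_comm] at h3
    refine h3.congr_of_eventuallyEq ?_
    filter_upwards [isOpen_Iio.mem_nhds hr.2] with t ht
    exact if_pos ht
  have h1 : g 1 = w := if_neg (lt_irrefl 1)
  have hder : HasDerivWithinAt g (ζ * d) (Set.Iic 1) 1 := by
    refine hasDerivWithinAt_Iic_of_tendsto_deriv (s := Set.Ioo 0 1)
      (fun r hr => (hgd r hr).differentiableAt.differentiableWithinAt) ?_
      Ioo_zero_one_mem_nhdsLT ?_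
    · rw [ContinuousWithinAt, h1]
      have h2 : Tendsto g (𝓝[<] 1) (𝓝 w) := by
        refine Tendsto.congr' ?_ hw
        filter_upwards [self_mem_nhdsWithin] with r hr
        exact (if_pos hr).symm
      exact h2.mono_left (nhdsWithin_mono _ fun r hr => hr.2)
    · refine Tendsto.congr' ?_ ((tendsto_const_nhds (x := (ζ : ℂ))).mul hd)
      filter_upwards [Ioo_zero_one_mem_nhdsLT] with r hr
      exact (hgd r hr).deriv.symm
  rw [hasDerivWithinAt_iff_tendsto_slope, Set.Iic_sdiff_right] at hder
  refine hder.congr' ?_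
  filter_upwards [self_mem_nhdsWithin] with r hr
  have hr' : r < 1 := hr
  rw [slope_def_module, h1]
  simp only [hg, if_pos hr']
  have h3 : (1 - (r : ℂ)) ≠ 0 := by
    rw [sub_ne_zero]
    exact_mod_cast hr'.ne'
  have h4 : ((r : ℂ) - 1) ≠ 0 := by
    rw [← neg_sub]
    exact neg_ne_zero.2 h3
  rw [Complex.real_smul]
  push_cast
  field_simp
  ring

section AngularPoint

variable {Θ : ℂ → ℂ} {ζ : Circle}

theorem IsInner.tendsto_slope (hΘ : IsInner Θ) (hζ : ζ ∈ angularSet Θ) :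
    Tendsto (fun r : ℝ => (boundaryValue Θ ζ - Θ (r * (ζ : ℂ))) / (1 - r)) (𝓝[<] 1)
      (𝓝 (ζ * angularDeriv Θ ζ)) :=
  tendsto_radial_slope hΘ.1.1 (hasRadialLimit_of_mem_angularSet hζ)
    (hasRadialLimit_deriv_of_mem_angularSet hζ)

theorem norm_ofReal_mul_circle {r : ℝ} (hr : r ∈ Set.Ioo (0 : ℝ) 1) (z : Circle) :
    ‖(r : ℂ) * (z : ℂ)‖ = r := by
  rw [norm_mul, Circle.norm_coe, mul_one, Complex.norm_real, Real.norm_of_nonneg hr.1.le]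

theorem norm_ofReal_mul_circle_lt {r : ℝ} (hr : r ∈ Set.Ioo (0 : ℝ) 1) (z : Circle) :
    ‖(r : ℂ) * (z : ℂ)‖ < 1 := by
  rw [norm_ofReal_mul_circle hr]
  exact hr.2

theorem IsInner.exists_norm_sub_le (hΘ : IsInner Θ) (hζ : ζ ∈ angularSet Θ) :
    ∃ C : ℝ, 0 ≤ C ∧ ∀ᶠ r : ℝ in 𝓝[<] 1, r ∈ Set.Ioo (0 : ℝ) 1 ∧
      ‖boundaryValue Θ ζ - Θ (r * (ζ : ℂ))‖ ≤ C * (1 - r) := by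
  refine ⟨‖(ζ : ℂ) * angularDeriv Θ ζ‖ + 1, by positivity, ?_⟩
  filter_upwards [Ioo_zero_one_mem_nhdsLT,
    (hΘ.tendsto_slope hζ).norm.eventually_lt_const (lt_add_one _)] with r hr h
  refine ⟨hr, ?_⟩
  have h1 : ‖(1 : ℂ) - r‖ = 1 - r := by
    rw [← Complex.ofReal_one, ← Complex.ofReal_sub, Complex.norm_real,
      Real.norm_of_nonneg (sub_nonneg.2 hr.2.le)]
  rw [norm_div, h1, div_lt_iff₀ (sub_pos.2 hr.2)] at h
  exact h.le

/-! ### The boundary kernel as a limit of reproducing kernels -/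

theorem one_sub_conj_mul_circle_ne_zero {z : Circle} (hz : z ≠ ζ) :
    1 - conj (ζ : ℂ) * (z : ℂ) ≠ 0 := by
  intro h
  refine hz (Circle.ext ?_)
  have h1 : conj (ζ : ℂ) * z = 1 := (sub_eq_zero.1 h).symm
  linear_combination (ζ : ℂ) * h1 - (z : ℂ) * circle_conj_mul ζ

theorem tendsto_boundaryKernel (hζ : ζ ∈ angularSet Θ) {z : Circle} (hz : z ≠ ζ) :
    Tendsto (fun r : ℝ => boundaryKernel Θ (Θ (r * (ζ : ℂ))) (r * (ζ : ℂ)) z) (𝓝[<] 1)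
      (𝓝 (boundaryKernel Θ (boundaryValue Θ ζ) ζ z)) := by
  have hc : Continuous fun r : ℝ => (r : ℂ) * (ζ : ℂ) := by fun_prop
  have h1 := hc.tendsto 1
  simp only [Complex.ofReal_one, one_mul] at h1
  have h2 := h1.mono_left (nhdsWithin_le_nhds (s := Set.Iio 1))
  have hw : Tendsto (fun r : ℝ => Θ (r * (ζ : ℂ))) (𝓝[<] 1) (𝓝 (boundaryValue Θ ζ)) :=
    hasRadialLimit_of_mem_angularSet hζ
  exact (tendsto_const_nhds.sub
    (((Complex.continuous_conj.tendsto _).comp hw).mul tendsto_const_nhds)).div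
    (tendsto_const_nhds.sub (((Complex.continuous_conj.tendsto _).comp h2).mul tendsto_const_nhds))
    (one_sub_conj_mul_circle_ne_zero hz)

/-- The majorant behind every dominated convergence below. Moving the base point from `ζ` to `rζ`
changes the numerator by at most `C (1 - r)`, while the new denominator is at least `1 - r` and at
least half the old one. -/
theorem norm_boundaryKernel_le {C r : ℝ} (hr : r ∈ Set.Ioo (0 : ℝ) 1)
    (hC : ‖boundaryValue Θ ζ - Θ (r * (ζ : ℂ))‖ ≤ C * (1 - r)) (hC0 : 0 ≤ C) {z : Circle}
    (hz : z ≠ ζ) (hθ : ‖boundaryValue Θ z‖ = 1) :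
    ‖boundaryKernel Θ (Θ (r * (ζ : ℂ))) (r * (ζ : ℂ)) z‖
      ≤ 2 * ‖boundaryKernel Θ (boundaryValue Θ ζ) ζ z‖ + C := by
  have hμ := norm_ofReal_mul_circle_lt hr ζ
  have hD : 0 < ‖1 - conj ((r : ℂ) * (ζ : ℂ)) * (z : ℂ)‖ :=
    norm_pos_iff.2 (one_sub_conj_mul_ne_zero hμ (Circle.norm_coe z).le)
  have hE : 0 < ‖1 - conj (ζ : ℂ) * (z : ℂ)‖ :=
    norm_pos_iff.2 (one_sub_conj_mul_circle_ne_zero hz)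
  have hD1 : 1 - r ≤ ‖1 - conj ((r : ℂ) * (ζ : ℂ)) * (z : ℂ)‖ := by
    have := one_sub_norm_le_norm_one_sub (μ := (r : ℂ) * (ζ : ℂ)) (Circle.norm_coe z).le
    rwa [norm_ofReal_mul_circle hr] at this
  -- The two denominators differ by a term of modulus `1 - r`, itself at most the new denominator by
  -- `hD1`; hence the factor 2.
  have hED : ‖1 - conj (ζ : ℂ) * (z : ℂ)‖ ≤ 2 * ‖1 - conj ((r : ℂ) * (ζ : ℂ)) * (z : ℂ)‖ := by
    have e : 1 - conj (ζ : ℂ) * (z : ℂ) = (1 - conj ((r : ℂ) * (ζ : ℂ)) * (z : ℂ))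
        - ((1 - r : ℝ) : ℂ) * (conj (ζ : ℂ) * z) := by
      simp only [map_mul, Complex.conj_ofReal]
      push_cast
      ring
    have h := norm_sub_le (1 - conj ((r : ℂ) * (ζ : ℂ)) * (z : ℂ))
      (((1 - r : ℝ) : ℂ) * (conj (ζ : ℂ) * z))
    rw [← e, norm_mul, norm_mul, RCLike.norm_conj, Circle.norm_coe, Circle.norm_coe,
      Complex.norm_real, Real.norm_of_nonneg (sub_nonneg.2 hr.2.le)] at h
    linarith
  have hN : ‖1 - conj (Θ (r * (ζ : ℂ))) * boundaryValue Θ z‖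
      ≤ ‖1 - conj (boundaryValue Θ ζ) * boundaryValue Θ z‖ + C * (1 - r) := by
    have e : 1 - conj (Θ (r * (ζ : ℂ))) * boundaryValue Θ z
        = (1 - conj (boundaryValue Θ ζ) * boundaryValue Θ z)
          + conj (boundaryValue Θ ζ - Θ (r * (ζ : ℂ))) * boundaryValue Θ z := by
      rw [map_sub]
      ring
    rw [e]
    refine (norm_add_le _ _).trans (add_le_add le_rfl ?_)
    rw [norm_mul, RCLike.norm_conj, hθ, mul_one]
    exact hC
  rw [boundaryKernel, boundaryKernel, norm_div, norm_div, div_le_iff₀ hD]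
  refine hN.trans ?_
  have h1 : ‖1 - conj (boundaryValue Θ ζ) * boundaryValue Θ z‖
      = ‖1 - conj (boundaryValue Θ ζ) * boundaryValue Θ z‖ / ‖1 - conj (ζ : ℂ) * (z : ℂ)‖
        * ‖1 - conj (ζ : ℂ) * (z : ℂ)‖ := (div_mul_cancel₀ _ hE.ne').symm
  set q := ‖1 - conj (boundaryValue Θ ζ) * boundaryValue Θ z‖ / ‖1 - conj (ζ : ℂ) * (z : ℂ)‖
    with hq
  have hq0 : 0 ≤ q := by positivity
  rw [h1]
  nlinarith [mul_le_mul_of_nonneg_left hED hq0, mul_le_mul_of_nonneg_left hD1 hC0]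

theorem IsInner.lintegral_boundaryKernel_sq (hΘ : IsInner Θ) {μ : ℂ} (hμ : ‖μ‖ < 1) :
    ∫⁻ z, ‖boundaryKernel Θ (Θ μ) μ z‖ₑ ^ 2 ∂arcLength
      = ENNReal.ofReal ((1 - ‖Θ μ‖ ^ 2) / (1 - ‖μ‖ ^ 2)) := by
  rw [← hΘ.integral_norm_boundaryKernel_sq hμ, ofReal_integral_eq_lintegral_ofReal
    ((hΘ.memLp_boundaryKernel (Θ μ) hμ 2).integrable_norm_pow two_ne_zero)
    (ae_of_all _ fun z => by positivity)]
  refine lintegral_congr fun z => ?_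
  rw [ENNReal.ofReal_pow (norm_nonneg _), ofReal_norm]

/-- At a point with finite angular derivative the boundary kernel is square integrable. -/
theorem IsInner.memLp_boundaryKernel_of_mem_angularSet (hΘ : IsInner Θ)
    (hζ : ζ ∈ angularSet Θ) :
    MemLp (boundaryKernel Θ (boundaryValue Θ ζ) ζ) 2 arcLength := by
  obtain ⟨C, hC0, hC⟩ := hΘ.exists_norm_sub_le hζ
  -- The constant comes from `1 - |Θ| ≤ C (1 - r)`, `1 + |Θ| ≤ 2 + C` and `1 - r ≤ 1 - r²`.
  have hbound : ∀ᶠ r : ℝ in 𝓝[<] 1,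
      ∫⁻ z, ‖boundaryKernel Θ (Θ (r * (ζ : ℂ))) (r * (ζ : ℂ)) z‖ₑ ^ 2 ∂arcLength
        ≤ ENNReal.ofReal (C * (2 + C)) := by
    filter_upwards [hC] with r ⟨hr, h⟩
    rw [hΘ.lintegral_boundaryKernel_sq (norm_ofReal_mul_circle_lt hr ζ),
      norm_ofReal_mul_circle hr]
    refine ENNReal.ofReal_le_ofReal ?_
    have hr1 : 0 < 1 - r ^ 2 := by nlinarith [hr.1, hr.2]
    rw [div_le_iff₀ hr1]
    have hw := norm_boundaryValue_of_mem_angularSet hζ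
    have h1 := norm_sub_norm_le (boundaryValue Θ ζ) (Θ (r * (ζ : ℂ)))
    have h2 := norm_sub_norm_le (Θ (r * (ζ : ℂ))) (boundaryValue Θ ζ)
    rw [norm_sub_rev] at h2
    rw [hw] at h1 h2
    have h0 := norm_nonneg (Θ (r * (ζ : ℂ)))
    set t := ‖Θ (r * (ζ : ℂ))‖
    have ht1 : 1 - t ≤ C * (1 - r) := h1.trans h
    have ht2 : t ≤ 1 + C := by nlinarith [hr.1, h2.trans h]
    have hC2 : 0 ≤ C * (1 - r) := mul_nonneg hC0 (sub_nonneg.2 hr.2.le)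
    calc 1 - t ^ 2 = (1 - t) * (1 + t) := by ring
      _ ≤ C * (1 - r) * (1 + t) := mul_le_mul_of_nonneg_right ht1 (by linarith)
      _ ≤ C * (1 - r) * (2 + C) := mul_le_mul_of_nonneg_left (by linarith) hC2
      _ ≤ C * (1 - r) * (2 + C) * (1 + r) :=
          le_mul_of_one_le_right (by positivity) (by linarith [hr.1])
      _ = C * (2 + C) * (1 - r ^ 2) := by ring
  have hm := hΘ.aestronglyMeasurable_boundaryKernel (boundaryValue Θ ζ) ζ
  refine ⟨hm, ?_⟩
  rw [eLpNorm_lt_top_iff_lintegral_rpow_enorm_lt_top two_ne_zero ENNReal.ofNat_ne_top]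
  simp only [ENNReal.toReal_ofNat, ENNReal.rpow_ofNat]
  refine lt_of_le_of_lt ?_ (ENNReal.ofReal_lt_top (r := C * (2 + C)))
  -- Fatou's lemma: the majorant is of no use yet, since it involves the very function whose
  -- integrability is sought.
  calc ∫⁻ z, ‖boundaryKernel Θ (boundaryValue Θ ζ) ζ z‖ₑ ^ 2 ∂arcLength
      = ∫⁻ z, liminf (fun r : ℝ =>
          ‖boundaryKernel Θ (Θ (r * (ζ : ℂ))) (r * (ζ : ℂ)) z‖ₑ ^ 2) (𝓝[<] 1) ∂arcLength := by
        refine lintegral_congr_ae ?_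
        filter_upwards [ae_ne ζ] with z hz
        exact (((ENNReal.continuous_pow 2).tendsto _).comp
          (tendsto_boundaryKernel hζ hz).enorm).liminf_eq.symm
    _ ≤ liminf (fun r : ℝ => ∫⁻ z,
          ‖boundaryKernel Θ (Θ (r * (ζ : ℂ))) (r * (ζ : ℂ)) z‖ₑ ^ 2 ∂arcLength) (𝓝[<] 1) :=
        lintegral_liminf_le' fun r =>
          (hΘ.aestronglyMeasurable_boundaryKernel _ _).enorm.pow_const 2
    _ ≤ ENNReal.ofReal (C * (2 + C)) :=
        liminf_le_of_frequently_le hbound.frequently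

theorem IsInner.tendsto_integral_mul_boundaryKernel_sq (hΘ : IsInner Θ) (hζ : ζ ∈ angularSet Θ)
    {φ : Circle → ℂ} (hφ : MemLp φ ∞ arcLength) :
    Tendsto (fun r : ℝ => ∫ z, φ z *
        ((‖boundaryKernel Θ (Θ (r * (ζ : ℂ))) (r * (ζ : ℂ)) z‖ ^ 2 : ℝ) : ℂ) ∂arcLength) (𝓝[<] 1)
      (𝓝 (∫ z, φ z *
        ((‖boundaryKernel Θ (boundaryValue Θ ζ) ζ z‖ ^ 2 : ℝ) : ℂ) ∂arcLength)) := by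
  obtain ⟨C, hC0, hC⟩ := hΘ.exists_norm_sub_le hζ
  have hk := hΘ.memLp_boundaryKernel_of_mem_angularSet hζ
  have hb : MemLp (fun z => 2 * ‖boundaryKernel Θ (boundaryValue Θ ζ) ζ z‖ + C) 2 arcLength :=
    (hk.norm.const_mul 2).add (memLp_const C)
  refine tendsto_integral_filter_of_dominated_convergence
    (fun z => ‖φ z‖ * (2 * ‖boundaryKernel Θ (boundaryValue Θ ζ) ζ z‖ + C) ^ 2) ?_ ?_ ?_ ?_
  · refine .of_forall fun r => hφ.1.mul ?_
    exact Complex.continuous_ofReal.comp_aestronglyMeasurable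
      ((hΘ.aestronglyMeasurable_boundaryKernel _ _).norm.pow 2)
  · filter_upwards [hC] with r ⟨hr, h⟩
    filter_upwards [ae_ne ζ, hΘ.ae_boundaryValue] with z hz hθ
    rw [norm_mul, Complex.norm_real, norm_pow, norm_norm]
    gcongr
    exact norm_boundaryKernel_le hr h hC0 hz hθ.2
  · exact memLp_one_iff_integrable.1
      ((memLp_one_iff_integrable.2 hb.integrable_sq).mul' hφ.norm)
  · filter_upwards [ae_ne ζ] with z hz
    exact tendsto_const_nhds.mul ((Complex.continuous_ofReal.tendsto _).comp
      ((tendsto_boundaryKernel hζ hz).norm.pow 2))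

/-- The reproducing identity survives the limit `lam = rζ → ζ` with `μ` fixed. -/
theorem IsInner.integral_conj_boundaryKernel_mul_of_mem_angularSet (hΘ : IsInner Θ)
    (hζ : ζ ∈ angularSet Θ) {μ : ℂ} (hμ : ‖μ‖ < 1) :
    ∫ z, conj (boundaryKernel Θ (Θ μ) μ z) * boundaryKernel Θ (boundaryValue Θ ζ) ζ z ∂arcLength
      = (1 - conj (boundaryValue Θ ζ) * Θ μ) / (1 - conj (ζ : ℂ) * μ) := by
  obtain ⟨C, hC0, hC⟩ := hΘ.exists_norm_sub_le hζ
  have hk := hΘ.memLp_boundaryKernel_of_mem_angularSet hζ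
  have hb : MemLp (fun z => 2 * ‖boundaryKernel Θ (boundaryValue Θ ζ) ζ z‖ + C) 2 arcLength :=
    (hk.norm.const_mul 2).add (memLp_const C)
  have hkμ := hΘ.memLp_boundaryKernel (Θ μ) hμ 2
  have h1 : Tendsto (fun r : ℝ => ∫ z, conj (boundaryKernel Θ (Θ μ) μ z)
      * boundaryKernel Θ (Θ (r * (ζ : ℂ))) (r * (ζ : ℂ)) z ∂arcLength) (𝓝[<] 1)
      (𝓝 (∫ z, conj (boundaryKernel Θ (Θ μ) μ z)
        * boundaryKernel Θ (boundaryValue Θ ζ) ζ z ∂arcLength)) := by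
    refine tendsto_integral_filter_of_dominated_convergence
      (fun z => ‖boundaryKernel Θ (Θ μ) μ z‖
        * (2 * ‖boundaryKernel Θ (boundaryValue Θ ζ) ζ z‖ + C)) ?_ ?_ ?_ ?_
    · exact .of_forall fun r => hkμ.star.1.mul (hΘ.aestronglyMeasurable_boundaryKernel _ _)
    · filter_upwards [hC] with r ⟨hr, h⟩
      filter_upwards [ae_ne ζ, hΘ.ae_boundaryValue] with z hz hθ
      rw [norm_mul, RCLike.norm_conj]
      gcongr
      exact norm_boundaryKernel_le hr h hC0 hz hθ.2
    · exact hkμ.norm.integrable_mul hb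
    · filter_upwards [ae_ne ζ] with z hz
      exact tendsto_const_nhds.mul (tendsto_boundaryKernel hζ hz)
  refine tendsto_nhds_unique h1 ?_
  have hc : Continuous fun r : ℝ => (r : ℂ) * (ζ : ℂ) := by fun_prop
  have h2 := hc.tendsto 1
  simp only [Complex.ofReal_one, one_mul] at h2
  have h3 := h2.mono_left (nhdsWithin_le_nhds (s := Set.Iio 1))
  have hw : Tendsto (fun r : ℝ => Θ (r * (ζ : ℂ))) (𝓝[<] 1) (𝓝 (boundaryValue Θ ζ)) :=
    hasRadialLimit_of_mem_angularSet hζ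
  have hne : 1 - conj (ζ : ℂ) * μ ≠ 0 := by
    intro h
    have h4 := one_sub_conj_mul_ne_zero hμ (Circle.norm_coe ζ).le
    refine h4 ?_
    have h5 := congrArg (starRingEnd ℂ) h
    rw [conj_one_sub_conj_mul, map_zero, mul_comm] at h5
    exact h5
  refine ((tendsto_const_nhds.sub
    (((Complex.continuous_conj.tendsto _).comp hw).mul tendsto_const_nhds)).div
    (tendsto_const_nhds.sub
      (((Complex.continuous_conj.tendsto _).comp h3).mul tendsto_const_nhds)) hne).congr' ?_
  filter_upwards [Ioo_zero_one_mem_nhdsLT] with r hr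
  exact (hΘ.integral_conj_boundaryKernel_mul (norm_ofReal_mul_circle_lt hr ζ) hμ).symm

/-- The squared norm of the boundary kernel is the modulus of the angular derivative. -/
theorem IsInner.integral_boundaryKernel_sq_eq (hΘ : IsInner Θ) (hζ : ζ ∈ angularSet Θ) :
    ∫ z, ‖boundaryKernel Θ (boundaryValue Θ ζ) ζ z‖ ^ 2 ∂arcLength = ‖angularDeriv Θ ζ‖ := by
  obtain ⟨C, hC0, hC⟩ := hΘ.exists_norm_sub_le hζ
  have hk := hΘ.memLp_boundaryKernel_of_mem_angularSet hζ
  have hb : MemLp (fun z => 2 * ‖boundaryKernel Θ (boundaryValue Θ ζ) ζ z‖ + C) 2 arcLength :=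
    (hk.norm.const_mul 2).add (memLp_const C)
  have hw := norm_boundaryValue_of_mem_angularSet hζ
  have hww : conj (boundaryValue Θ ζ) * boundaryValue Θ ζ = 1 := by
    rw [Complex.conj_mul', hw]
    simp
  have h1 : Tendsto (fun r : ℝ => ∫ z, conj (boundaryKernel Θ (Θ (r * (ζ : ℂ))) (r * (ζ : ℂ)) z)
      * boundaryKernel Θ (boundaryValue Θ ζ) ζ z ∂arcLength) (𝓝[<] 1)
      (𝓝 (∫ z, conj (boundaryKernel Θ (boundaryValue Θ ζ) ζ z)
        * boundaryKernel Θ (boundaryValue Θ ζ) ζ z ∂arcLength)) := by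
    refine tendsto_integral_filter_of_dominated_convergence
      (fun z => (2 * ‖boundaryKernel Θ (boundaryValue Θ ζ) ζ z‖ + C)
        * ‖boundaryKernel Θ (boundaryValue Θ ζ) ζ z‖) ?_ ?_ ?_ ?_
    · exact .of_forall fun r => (Complex.continuous_conj.comp_aestronglyMeasurable
        (hΘ.aestronglyMeasurable_boundaryKernel _ _)).mul hk.1
    · filter_upwards [hC] with r ⟨hr, h⟩
      filter_upwards [ae_ne ζ, hΘ.ae_boundaryValue] with z hz hθ
      rw [norm_mul, RCLike.norm_conj]
      gcongr
      exact norm_boundaryKernel_le hr h hC0 hz hθ.2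
    · exact hb.integrable_mul hk.norm
    · filter_upwards [ae_ne ζ] with z hz
      exact ((Complex.continuous_conj.tendsto _).comp (tendsto_boundaryKernel hζ hz)).mul
        tendsto_const_nhds
  -- The pairing equals `(1 - conj Θ(ζ) Θ(rζ)) / (1 - r)`, which is `conj Θ(ζ)` times the radial
  -- slope because `|Θ(ζ)| = 1`.
  have h2 := (hΘ.tendsto_slope hζ).const_mul (conj (boundaryValue Θ ζ))
  have h3 := tendsto_nhds_unique (h1.congr' ?_) h2
  · simp_rw [Complex.conj_mul'] at h3
    have h4 := congrArg norm h3
    rw [norm_mul, norm_mul, RCLike.norm_conj, hw, Circle.norm_coe, one_mul, one_mul] at h4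
    rw [← h4]
    have h5 : ∫ z, (‖boundaryKernel Θ (boundaryValue Θ ζ) ζ z‖ : ℂ) ^ 2 ∂arcLength
        = ((∫ z, ‖boundaryKernel Θ (boundaryValue Θ ζ) ζ z‖ ^ 2 ∂arcLength : ℝ) : ℂ) := by
      rw [← integral_complex_ofReal]
      push_cast
      rfl
    rw [h5, Complex.norm_real, Real.norm_of_nonneg (integral_nonneg fun z => by positivity)]
  · filter_upwards [Ioo_zero_one_mem_nhdsLT] with r hr
    rw [hΘ.integral_conj_boundaryKernel_mul_of_mem_angularSet hζ (norm_ofReal_mul_circle_lt hr ζ)]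
    have e : conj (ζ : ℂ) * ((r : ℂ) * (ζ : ℂ)) = r := by
      rw [mul_left_comm, circle_conj_mul, mul_one]
    rw [e]
    linear_combination (-1 / (1 - (r : ℂ))) * hww

/-- If the derivative vanished, `k_ζ` would have norm zero, so `Θ = Θ(ζ)` almost everywhere on the
circle, and Cauchy's formula would make `Θ` constant on the disc. -/
theorem IsInner.angularDeriv_ne_zero (hΘ : IsInner Θ)
    (hΘ' : ¬ ∃ c : ℂ, ∀ z ∈ Metric.ball (0 : ℂ) 1, Θ z = c) (hζ : ζ ∈ angularSet Θ) :
    angularDeriv Θ ζ ≠ 0 := by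
  intro hd
  refine hΘ' ⟨boundaryValue Θ ζ, fun μ hμ => ?_⟩
  rw [mem_ball_zero_iff] at hμ
  have h := hΘ.integral_boundaryKernel_sq_eq hζ
  rw [hd, norm_zero, integral_eq_zero_iff_of_nonneg (fun z => by positivity)
    ((hΘ.memLp_boundaryKernel_of_mem_angularSet hζ).integrable_norm_pow two_ne_zero)] at h
  rw [← integral_div_cauchy hΘ.1 hΘ.ae_hasRadialLimit hμ,
    ← integral_div_cauchy (isBoundedAnalytic_const (boundaryValue Θ ζ))
      (ae_of_all _ fun _ => tendsto_const_nhds) hμ]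
  refine integral_congr_ae ?_
  filter_upwards [h, ae_ne ζ] with z hz hne
  have h1 : boundaryKernel Θ (boundaryValue Θ ζ) ζ z = 0 := by simpa using hz
  rw [boundaryKernel, div_eq_zero_iff, or_iff_left (one_sub_conj_mul_circle_ne_zero hne)] at h1
  have hww : conj (boundaryValue Θ ζ) * boundaryValue Θ ζ = 1 := by
    rw [Complex.conj_mul', norm_boundaryValue_of_mem_angularSet hζ]
    simp
  have h2 : boundaryValue Θ z = boundaryValue Θ ζ := by
    linear_combination (-boundaryValue Θ z) * hww - boundaryValue Θ ζ * h1
  rw [h2]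

theorem norm_one_sub_conj_mul {w : ℂ} (hw : ‖w‖ = 1) (v : ℂ) : ‖1 - conj w * v‖ = ‖v - w‖ := by
  have hww : conj w * w = 1 := by
    rw [Complex.conj_mul', hw]
    simp
  have e : 1 - conj w * v = conj w * (w - v) := by linear_combination -hww
  rw [e, norm_mul, RCLike.norm_conj, hw, one_mul, norm_sub_rev]

theorem kernelSq_eq (hζ : ζ ∈ angularSet Θ) (z : Circle) :
    kernelSq Θ ζ z = ‖boundaryKernel Θ (boundaryValue Θ ζ) ζ z‖ ^ 2 := by
  rw [kernelSq, boundaryKernel, norm_div, norm_div,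
    norm_one_sub_conj_mul (norm_boundaryValue_of_mem_angularSet hζ),
    norm_one_sub_conj_mul (Circle.norm_coe ζ)]

end AngularPoint

/-! ### The measures `ν_ζ` and the limiting estimates -/

section AngularPoint

variable {Θ : ℂ → ℂ} {ζ : Circle}

theorem IsInner.integrable_kernelSq (hΘ : IsInner Θ) (hζ : ζ ∈ angularSet Θ) :
    Integrable (kernelSq Θ ζ) arcLength :=
  ((hΘ.memLp_boundaryKernel_of_mem_angularSet hζ).integrable_norm_pow two_ne_zero).congr
    (ae_of_all _ fun z => (kernelSq_eq hζ z).symm)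

theorem IsInner.integral_kernelSq (hΘ : IsInner Θ) (hζ : ζ ∈ angularSet Θ) :
    ∫ z, kernelSq Θ ζ z ∂arcLength = ‖angularDeriv Θ ζ‖ := by
  simp_rw [kernelSq_eq hζ]
  exact hΘ.integral_boundaryKernel_sq_eq hζ

theorem kernelSq_nonneg (Θ : ℂ → ℂ) (ζ z : Circle) : 0 ≤ kernelSq Θ ζ z := sq_nonneg _

theorem IsInner.isProbabilityMeasure_angularMeasure (hΘ : IsInner Θ) (hζ : ζ ∈ angularSet Θ)
    (hd : angularDeriv Θ ζ ≠ 0) : IsProbabilityMeasure (angularMeasure Θ ζ) := by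
  constructor
  rw [angularMeasure, withDensity_apply _ MeasurableSet.univ, Measure.restrict_univ,
    ← ofReal_integral_eq_lintegral_ofReal ((hΘ.integrable_kernelSq hζ).const_mul _)
      (ae_of_all _ fun z => mul_nonneg (by positivity) (kernelSq_nonneg Θ ζ z)),
    integral_const_mul, hΘ.integral_kernelSq hζ, one_div_mul_cancel (norm_ne_zero_iff.2 hd),
    ENNReal.ofReal_one]

theorem IsInner.aemeasurable_density (hΘ : IsInner Θ) (hζ : ζ ∈ angularSet Θ) :
    AEMeasurable (fun z => ENNReal.ofReal (1 / ‖angularDeriv Θ ζ‖ * kernelSq Θ ζ z)) arcLength :=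
  ((hΘ.integrable_kernelSq hζ).const_mul _).aestronglyMeasurable.aemeasurable.ennreal_ofReal

theorem toReal_density (z : Circle) :
    (ENNReal.ofReal (1 / ‖angularDeriv Θ ζ‖ * kernelSq Θ ζ z)).toReal
      = 1 / ‖angularDeriv Θ ζ‖ * kernelSq Θ ζ z :=
  ENNReal.toReal_ofReal (mul_nonneg (by positivity) (kernelSq_nonneg Θ ζ z))

theorem IsInner.integrable_mul_kernelSq (hΘ : IsInner Θ) (hζ : ζ ∈ angularSet Θ)
    {φ : Circle → ℂ} (hφ : MemLp φ ∞ arcLength) :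
    Integrable (fun z => φ z * (kernelSq Θ ζ z : ℂ)) arcLength := by
  have h : MemLp (fun z => (kernelSq Θ ζ z : ℂ)) 1 arcLength :=
    memLp_one_iff_integrable.2 (hΘ.integrable_kernelSq hζ).ofReal
  exact memLp_one_iff_integrable.1 (h.mul' hφ)

theorem IsInner.integrable_angularMeasure (hΘ : IsInner Θ) (hζ : ζ ∈ angularSet Θ)
    {φ : Circle → ℂ} (hφ : MemLp φ ∞ arcLength) : Integrable φ (angularMeasure Θ ζ) := by
  rw [angularMeasure, integrable_withDensity_iff_integrable_smul₀'
    (hΘ.aemeasurable_density hζ) (ae_of_all _ fun _ => ENNReal.ofReal_lt_top)]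
  refine ((hΘ.integrable_mul_kernelSq hζ hφ).const_mul
    ((1 / ‖angularDeriv Θ ζ‖ : ℝ) : ℂ)).congr (ae_of_all _ fun z => ?_)
  dsimp only
  rw [toReal_density, Complex.real_smul]
  push_cast
  ring

theorem IsInner.integral_angularMeasure (hΘ : IsInner Θ) (hζ : ζ ∈ angularSet Θ)
    (φ : Circle → ℂ) : ∫ z, φ z ∂angularMeasure Θ ζ
      = ((1 / ‖angularDeriv Θ ζ‖ : ℝ) : ℂ) * ∫ z, φ z * (kernelSq Θ ζ z : ℂ) ∂arcLength := by
  rw [angularMeasure, integral_withDensity_eq_integral_toReal_smul₀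
    (hΘ.aemeasurable_density hζ) (ae_of_all _ fun _ => ENNReal.ofReal_lt_top),
    ← integral_const_mul]
  refine integral_congr_ae (ae_of_all _ fun z => ?_)
  dsimp only
  rw [toReal_density, Complex.real_smul]
  push_cast
  ring

theorem IsInner.lintegral_angularMeasure (hΘ : IsInner Θ) (hζ : ζ ∈ angularSet Θ)
    {φ : Circle → ℝ} (hφ : AEMeasurable φ arcLength) :
    ∫⁻ z, ENNReal.ofReal (φ z) ∂angularMeasure Θ ζ
      = ENNReal.ofReal (1 / ‖angularDeriv Θ ζ‖)
        * ∫⁻ z, ENNReal.ofReal (φ z * kernelSq Θ ζ z) ∂arcLength := by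
  have hm : AEMeasurable (fun z => ENNReal.ofReal (φ z * kernelSq Θ ζ z)) arcLength :=
    (hφ.mul (hΘ.integrable_kernelSq hζ).aestronglyMeasurable.aemeasurable).ennreal_ofReal
  rw [angularMeasure, lintegral_withDensity_eq_lintegral_mul₀ (hΘ.aemeasurable_density hζ)
    hφ.ennreal_ofReal, ← lintegral_const_mul'' _ hm]
  refine lintegral_congr fun z => ?_
  rw [Pi.mul_apply, ENNReal.ofReal_mul (by positivity), mul_assoc,
    ← ENNReal.ofReal_mul (kernelSq_nonneg Θ ζ z), mul_comm (kernelSq Θ ζ z)]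

theorem IsInner.tendsto_toeplitzNorm_mul (hΘ : IsInner Θ) (hζ : ζ ∈ angularSet Θ)
    (hd : angularDeriv Θ ζ ≠ 0) (T : ℝ≥0∞) :
    Tendsto (fun r : ℝ => T * ENNReal.ofReal
        (∫ z, ‖boundaryKernel Θ (Θ (r * (ζ : ℂ))) (r * (ζ : ℂ)) z‖ ^ 2 ∂arcLength)) (𝓝[<] 1)
      (𝓝 (T * ENNReal.ofReal ‖angularDeriv Θ ζ‖)) := by
  have h := hΘ.tendsto_integral_mul_boundaryKernel_sq hζ (φ := fun _ => 1) (memLp_const 1)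
  simp only [one_mul, integral_complex_ofReal, hΘ.integral_boundaryKernel_sq_eq hζ] at h
  have h1 := (Complex.continuous_re.tendsto _).comp h
  -- Here `T` may be `∞`, and multiplication by `∞` is discontinuous at 0; the nonzero derivative
  -- excludes that limit.
  refine ENNReal.Tendsto.const_mul (ENNReal.tendsto_ofReal h1) (Or.inl ?_)
  rw [Ne, ENNReal.ofReal_eq_zero, not_le]
  exact norm_pos_iff.2 hd

theorem IsInner.enorm_integral_mul_kernelSq_le (hΘ : IsInner Θ) (hζ : ζ ∈ angularSet Θ)
    (hd : angularDeriv Θ ζ ≠ 0) {φ : L2} (hφ : MemLp φ ∞ arcLength) :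
    ‖∫ z, φ z * (kernelSq Θ ζ z : ℂ) ∂arcLength‖ₑ
      ≤ toeplitzNorm Θ φ * ENNReal.ofReal ‖angularDeriv Θ ζ‖ := by
  simp_rw [kernelSq_eq hζ]
  refine le_of_tendsto_of_tendsto (hΘ.tendsto_integral_mul_boundaryKernel_sq hζ hφ).enorm
    (hΘ.tendsto_toeplitzNorm_mul hζ hd _) ?_
  filter_upwards [Ioo_zero_one_mem_nhdsLT] with r hr
  exact hΘ.enorm_integral_mul_boundaryKernel_le φ (norm_ofReal_mul_circle_lt hr ζ)

/-- For `μ` inside the disc the kernel is bounded, so `φ |k_μ|²` is integrable and its extended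
integral agrees with the Bochner one. -/
theorem IsInner.lintegral_mul_boundaryKernel_le (hΘ : IsInner Θ) {φ : L2}
    (hφ : ∀ᵐ z ∂arcLength, 0 ≤ (φ z).re ∧ (φ z).im = 0) {μ : ℂ} (hμ : ‖μ‖ < 1) :
    ∫⁻ z, ENNReal.ofReal ((φ z).re * ‖boundaryKernel Θ (Θ μ) μ z‖ ^ 2) ∂arcLength
      ≤ toeplitzNorm Θ φ
        * ENNReal.ofReal (∫ z, ‖boundaryKernel Θ (Θ μ) μ z‖ ^ 2 ∂arcLength) := by
  refine le_trans (le_of_eq ?_) (hΘ.enorm_integral_mul_boundaryKernel_le φ hμ)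
  have hk := (hΘ.memLp_boundaryKernel (Θ μ) hμ ∞).norm
  have hi : Integrable (fun z => (φ z).re * ‖boundaryKernel Θ (Θ μ) μ z‖ ^ 2) arcLength := by
    simp_rw [pow_two]
    exact memLp_one_iff_integrable.1 ((hk.mul' hk (r := ∞)).mul'
      (memLp_one_iff_integrable.2 (integrable_of_memL2 φ).re))
  have e : ∫ z, φ z * ((‖boundaryKernel Θ (Θ μ) μ z‖ ^ 2 : ℝ) : ℂ) ∂arcLength
      = ((∫ z, (φ z).re * ‖boundaryKernel Θ (Θ μ) μ z‖ ^ 2 ∂arcLength : ℝ) : ℂ) := by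
    rw [← integral_complex_ofReal]
    refine integral_congr_ae ?_
    filter_upwards [hφ] with z hz
    have h1 : φ z = ((φ z).re : ℂ) := Complex.ext rfl (by simpa using hz.2)
    rw [Complex.ofReal_mul, ← h1]
  have h0 : 0 ≤ᵐ[arcLength] fun z => (φ z).re * ‖boundaryKernel Θ (Θ μ) μ z‖ ^ 2 :=
    hφ.mono fun z hz => mul_nonneg hz.1 (sq_nonneg _)
  rw [e, ← ofReal_integral_eq_lintegral_ofReal hi h0, ← ofReal_norm, Complex.norm_real,
    Real.norm_of_nonneg (integral_nonneg_of_ae h0)]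

/-- Fatou replaces dominated convergence: `φ |k_ζ|²` need not be integrable for unbounded `φ`, but
positivity gives the one inequality required. -/
theorem IsInner.lintegral_mul_kernelSq_le (hΘ : IsInner Θ) (hζ : ζ ∈ angularSet Θ)
    (hd : angularDeriv Θ ζ ≠ 0) {φ : L2}
    (hφ : ∀ᵐ z ∂arcLength, 0 ≤ (φ z).re ∧ (φ z).im = 0) :
    ∫⁻ z, ENNReal.ofReal ((φ z).re * kernelSq Θ ζ z) ∂arcLength
      ≤ toeplitzNorm Θ φ * ENNReal.ofReal ‖angularDeriv Θ ζ‖ := by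
  simp_rw [kernelSq_eq hζ]
  have hm : AEMeasurable (fun z => (φ z).re) arcLength :=
    (Complex.continuous_re.comp_aestronglyMeasurable (Lp.aestronglyMeasurable φ)).aemeasurable
  calc ∫⁻ z, ENNReal.ofReal ((φ z).re * ‖boundaryKernel Θ (boundaryValue Θ ζ) ζ z‖ ^ 2) ∂arcLength
      = ∫⁻ z, liminf (fun r : ℝ => ENNReal.ofReal ((φ z).re
          * ‖boundaryKernel Θ (Θ (r * (ζ : ℂ))) (r * (ζ : ℂ)) z‖ ^ 2)) (𝓝[<] 1) ∂arcLength := by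
        refine lintegral_congr_ae ?_
        filter_upwards [ae_ne ζ] with z hz
        exact (ENNReal.tendsto_ofReal (tendsto_const_nhds.mul
          ((tendsto_boundaryKernel hζ hz).norm.pow 2))).liminf_eq.symm
    _ ≤ liminf (fun r : ℝ => ∫⁻ z, ENNReal.ofReal ((φ z).re
          * ‖boundaryKernel Θ (Θ (r * (ζ : ℂ))) (r * (ζ : ℂ)) z‖ ^ 2) ∂arcLength) (𝓝[<] 1) :=
        lintegral_liminf_le' fun r => (hm.mul
          ((hΘ.aestronglyMeasurable_boundaryKernel _ _).norm.aemeasurable.pow_const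
            2)).ennreal_ofReal
    _ ≤ liminf (fun r : ℝ => toeplitzNorm Θ φ * ENNReal.ofReal
          (∫ z, ‖boundaryKernel Θ (Θ (r * (ζ : ℂ))) (r * (ζ : ℂ)) z‖ ^ 2 ∂arcLength))
          (𝓝[<] 1) := by
        refine liminf_le_liminf ?_
        filter_upwards [Ioo_zero_one_mem_nhdsLT] with r hr
        exact hΘ.lintegral_mul_boundaryKernel_le hφ (norm_ofReal_mul_circle_lt hr ζ)
    _ = toeplitzNorm Θ φ * ENNReal.ofReal ‖angularDeriv Θ ζ‖ :=
        (hΘ.tendsto_toeplitzNorm_mul hζ hd _).liminf_eq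

theorem ofReal_one_div_mul_le {d : ℂ} (hd : d ≠ 0) {a T : ℝ≥0∞}
    (h : a ≤ T * ENNReal.ofReal ‖d‖) : ENNReal.ofReal (1 / ‖d‖) * a ≤ T := by
  have hd0 := norm_pos_iff.2 hd
  rw [one_div, ENNReal.ofReal_inv_of_pos hd0, mul_comm, ← div_eq_mul_inv]
  exact ENNReal.div_le_of_le_mul h

end AngularPoint

end TruncatedToeplitz

theorem corollary2p4 (Θ : ℂ → ℂ) (hΘ : IsInner Θ)
    (hΘ' : ¬ ∃ c : ℂ, ∀ z ∈ Metric.ball (0 : ℂ) 1, Θ z = c) :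
    -- the `ν_ζ` are probability measures
    (∀ ζ ∈ angularSet Θ, angularDeriv Θ ζ ≠ 0 ∧ IsProbabilityMeasure (angularMeasure Θ ζ)) ∧
    -- bounded symbols
    (∀ φ : L2, MemLp φ ∞ arcLength →
      (∀ ζ ∈ angularSet Θ, Integrable (fun z => φ z * (kernelSq Θ ζ z : ℂ)) arcLength ∧
        Integrable φ (angularMeasure Θ ζ)) ∧
      (⨆ ζ ∈ angularSet Θ, ENNReal.ofReal
          (1 / ‖angularDeriv Θ ζ‖ * ‖∫ z, φ z * (kernelSq Θ ζ z : ℂ) ∂arcLength‖))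
        ≤ toeplitzNorm Θ φ ∧
      (⨆ ζ ∈ angularSet Θ, ENNReal.ofReal ‖∫ z, φ z ∂angularMeasure Θ ζ‖)
        ≤ toeplitzNorm Θ φ) ∧
    -- nonnegative square-integrable symbols; here the integrals may be infinite
    (∀ φ : L2, (∀ᵐ z ∂arcLength, 0 ≤ (φ z).re ∧ (φ z).im = 0) →
      (⨆ ζ ∈ angularSet Θ, ENNReal.ofReal (1 / ‖angularDeriv Θ ζ‖) *
          ∫⁻ z, ENNReal.ofReal ((φ z).re * kernelSq Θ ζ z) ∂arcLength)
        ≤ toeplitzNorm Θ φ ∧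
      (⨆ ζ ∈ angularSet Θ, ∫⁻ z, ENNReal.ofReal (φ z).re ∂angularMeasure Θ ζ)
        ≤ toeplitzNorm Θ φ) := by
  have hne : ∀ ζ ∈ angularSet Θ, angularDeriv Θ ζ ≠ 0 := fun ζ hζ =>
    hΘ.angularDeriv_ne_zero hΘ' hζ
  refine ⟨fun ζ hζ => ⟨hne ζ hζ, hΘ.isProbabilityMeasure_angularMeasure hζ (hne ζ hζ)⟩,
    fun φ hφ => ?_, fun φ hφ => ?_⟩
  · have key : ∀ ζ ∈ angularSet Θ, ENNReal.ofReal
        (1 / ‖angularDeriv Θ ζ‖ * ‖∫ z, φ z * (kernelSq Θ ζ z : ℂ) ∂arcLength‖)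
          ≤ toeplitzNorm Θ φ := by
      intro ζ hζ
      rw [ENNReal.ofReal_mul (by positivity), ofReal_norm]
      exact ofReal_one_div_mul_le (hne ζ hζ)
        (hΘ.enorm_integral_mul_kernelSq_le hζ (hne ζ hζ) hφ)
    refine ⟨fun ζ hζ => ⟨hΘ.integrable_mul_kernelSq hζ hφ, hΘ.integrable_angularMeasure hζ hφ⟩,
      iSup₂_le key, iSup₂_le fun ζ hζ => ?_⟩
    rw [hΘ.integral_angularMeasure hζ, norm_mul, Complex.norm_real,
      Real.norm_of_nonneg (by positivity)]
    exact key ζ hζ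
  · have key : ∀ ζ ∈ angularSet Θ, ENNReal.ofReal (1 / ‖angularDeriv Θ ζ‖)
        * ∫⁻ z, ENNReal.ofReal ((φ z).re * kernelSq Θ ζ z) ∂arcLength ≤ toeplitzNorm Θ φ :=
      fun ζ hζ => ofReal_one_div_mul_le (hne ζ hζ)
        (hΘ.lintegral_mul_kernelSq_le hζ (hne ζ hζ) hφ)
    refine ⟨iSup₂_le key, iSup₂_le fun ζ hζ => ?_⟩
    rw [hΘ.lintegral_angularMeasure hζ
      (Complex.continuous_re.comp_aestronglyMeasurable (Lp.aestronglyMeasurable φ)).aemeasurable]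
    exact key ζ hζ
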